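/- Let $n\ge 1$ and let $\mathfrak g=Q(n)$ be the complex queer Lie superalgebra of block matrices $\begin{pmatrix}A&B\\B&A\end{pmatrix}$ with $A,B\in M_n(\mathbb C)$, where $B=0$ gives the even part and $A=0$ the odd part, with bracket the supercommutator. Let $e_{i,j}$ (even, $A=E_{ij}$, $B=0$) and $f_{i,j}$ (odd, $A=0$, $B=E_{ij}$) be its standard basis. Put $\operatorname{otr}\begin{pmatrix}A&B\\B&A\end{pmatrix}=\operatorname{tr}B$, $E=\sum_{i=1}^{n-1}f_{i,i+1}$, and let $\chi\in\mathfrak g^*$ be the regular nilpotent even functional $\chi(x)=\operatorname{otr}(xE)$. Grade $\mathfrak g$ by the eigenvalues of $\operatorname{ad}h$, where $h=\sum_{i=1}^n(n+1-2i)e_{i,i}$, and put $\mathfrak m=\bigoplus_{j=1}^{n-1}\mathfrak g_{-2j}$. Let $I_\chi$ be the left ideal of the universal enveloping superalgebra $U(\mathfrak g)$ generated by all $a-\chi(a)$ with $a\in\mathfrak m$, let $\pi:U(\mathfrak g)\to U(\mathfrak g)/I_\chi$ be the projection, and let $$W_\chi=\{\pi(y)\in U(\mathfrak g)/I_\chi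 \mid (a-\chi(a))y\in I_\chi\text{ for all }a\in\mathfrak m\},\qquad \pi(y_1)\pi(y_2)=\pi(y_1y_2),$$ be the finite $W$-algebra, with the $\mathbb Z_2$-grading induced from $U(\mathfrak g)$. Define elements of $U(\mathfrak g)$ by $e^{(0)}_{i,j}=\delta_{ij}$, $f^{(0)}_{i,j}=0$ and, for $m\ge1$, $$e_{i,j}^{(m)}=\sum_{k=1}^n e_{i,k}e_{k,j}^{(m-1)}+(-1)^{m+1}\sum_{k=1}^n f_{i,k}f_{k,j}^{(m-1)},\qquad f_{i,j}^{(m)}=\sum_{k=1}^n e_{i,k}f_{k,j}^{(m-1)}+(-1)^{m+1}\sum_{k=1}^n f_{i,k}e_{k,j}^{(m-1)}.$$ Let $Y(Q(1))$ be the Nazarov–Sergeev super-Yangian of $Q(1)$: the unital associative $\mathbb C$-superalgebra with generators $T_{i,j}^{(m)}$ ($m\ge1$; $i,j\in\{1,-1\}$) of parity $p(i)+p(j)$, where $p(1)=0$ and $p(-1)=1$, and with the following defining relations for all $i,j,k,l\in\{1,-1\}$, in terms of $T_{i,j}(u)=\delta_{ij}+\sum_{m\ge1}T_{i,j}^{(m)}u^{-m}$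 and the supercommutator $[\,,]$: $$\begin{aligned}&(u^2-v^2)[T_{i,j}(u),T_{k,l}(v)](-1)^{p(i)p(k)+p(i)p(l)+p(k)p(l)}\\&\quad=(u+v)\bigl(T_{k,j}(u)T_{i,l}(v)-T_{k,j}(v)T_{i,l}(u)\bigr)\\&\qquad-(u-v)\bigl(T_{-k,j}(u)T_{-i,l}(v)-T_{k,-j}(v)T_{i,-l}(u)\bigr)(-1)^{p(k)+p(l)},\\&T_{i,j}(-u)=T_{-i,-j}(u).\end{aligned}$$ Then $\pi(e_{n,1}^{(n+k-1)})$ and $\pi(f_{n,1}^{(n+k-1)})$ lie in $W_\chi$ for all $k\ge1$, and there is a surjective, parity-preserving homomorphism of unital $\mathbb C$-algebras $\varphi:Y(Q(1))\to W_\chi$ such that, for all $k\ge1$, $$\varphi(T_{1,1}^{(k)})=(-1)^k\pi(e_{n,1}^{(n+k-1)}),\qquad \varphi(T_{-1,1}^{(k)})=(-1)^k\pi(f_{n,1}^{(n+k-1)}).$$ -/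

import Mathlib

open Matrix

noncomputable section

/-- Given elements `g s` of an algebra with prescribed parities `p s`, the span of all products
`g s₁ * ⋯ * g sᵣ` (`r ≥ 0`) of total parity `d`. For homogeneous generators of a superalgebra
this is its component of parity `d`. -/
def parityPart {A S : Type*} [Ring A] [Algebra ℂ A] (g : S → A) (p : S → ZMod 2) (d : ZMod 2) :
    Submodule ℂ A :=
  Submodule.span ℂ {x | ∃ l : List S, (l.map p).sum = d ∧ (l.map g).prod = x}

/-! ### The queer Lie superalgebra `Q(n)` -/

/-- The block matrices `(A B; B A)`. They are closed under the matrix product, and the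
superbracket of `Q(n)` is the supercommutator `x * y - (-1)^(|x||y|) y * x`. -/
def Queer (n : ℕ) : Subalgebra ℂ (Matrix (Fin n ⊕ Fin n) (Fin n ⊕ Fin n) ℂ) where
  carrier := {X | ∃ A B : Matrix (Fin n) (Fin n) ℂ, X = fromBlocks A B B A}
  mul_mem' := by
    rintro _ _ ⟨A, B, rfl⟩ ⟨C, D, rfl⟩
    exact ⟨A * C + B * D, A * D + B * C, by
      rw [fromBlocks_multiply, add_comm (B * C), add_comm (B * D) (A * C)]⟩
  add_mem' := by
    rintro _ _ ⟨A, B, rfl⟩ ⟨C, D, rfl⟩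
    exact ⟨A + C, B + D, by rw [fromBlocks_add]⟩
  algebraMap_mem' r := ⟨r • 1, 0, by
    rw [Algebra.algebraMap_eq_smul_one, ← fromBlocks_one, fromBlocks_smul, smul_zero]⟩

namespace Queer

/-- Rows and columns of the first block are even, those of the second block are odd. -/
def blockParity {n : ℕ} : Fin n ⊕ Fin n → ZMod 2 := Sum.elim (fun _ => 0) (fun _ => 1)

/-- The component of parity `d` of `Q(n)`: even elements are `(A 0; 0 A)`, odd elements are
`(0 B; B 0)`. -/
def part (n : ℕ) (d : ZMod 2) : Submodule ℂ (Queer n) where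
  carrier := {x | ∀ a b, blockParity a + blockParity b ≠ d → x.1 a b = 0}
  zero_mem' := fun _ _ _ => rfl
  add_mem' := fun hx hy a b hab => by simp [hx a b hab, hy a b hab]
  smul_mem' := fun c x hx a b hab => by simp [hx a b hab]

/-- The even basis element `e_{i,j}`. -/
def e {n : ℕ} (i j : Fin n) : Queer n :=
  ⟨fromBlocks (single i j 1) 0 0 (single i j 1), _, _, rfl⟩

/-- The odd basis element `f_{i,j}`. -/
def f {n : ℕ} (i j : Fin n) : Queer n :=
  ⟨fromBlocks 0 (single i j 1) (single i j 1) 0, _, _, rfl⟩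

/-- `otr (A B; B A) = tr B`. -/
def otr {n : ℕ} (x : Queer n) : ℂ := trace (toBlocks₁₂ x.1)

/-- The odd element `E = ∑ f_{i,i+1}`. -/
def E (n : ℕ) : Queer n :=
  ∑ i : Fin n, ∑ j : Fin n, if (j : ℕ) = i + 1 then f i j else 0

/-- The regular nilpotent even functional `χ(x) = (x|E) = otr (x E)`. -/
def chi {n : ℕ} (x : Queer n) : ℂ := otr (x * E n)

/-- `h = diag (n-1, n-3, …, 1-n)`, repeated in both diagonal blocks. -/
def h (n : ℕ) : Queer n := ∑ i : Fin n, ((n : ℂ) - 1 - 2 * (i : ℕ)) • e i i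

/-- The degree `j` component of the Dynkin grading, `{x | [h, x] = j x}`. -/
def dynkin (n : ℕ) (j : ℤ) : Submodule ℂ (Queer n) where
  carrier := {x | h n * x - x * h n = (j : ℂ) • x}
  zero_mem' := by simp
  add_mem' := fun {x y} hx hy => by
    simp only [Set.mem_ofPred_eq] at hx hy ⊢
    rw [smul_add, ← hx, ← hy, mul_add, add_mul]; abel
  smul_mem' := fun c x hx => by
    simp only [Set.mem_ofPred_eq] at hx ⊢
    rw [smul_comm, ← hx, smul_sub, mul_smul_comm, smul_mul_assoc]

/-- `m = ⨁_{1 ≤ j ≤ n-1} g_{-2j}`. -/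
def m (n : ℕ) : Submodule ℂ (Queer n) :=
  ⨆ j ∈ Finset.Icc 1 (n - 1), dynkin n (-2 * (j : ℤ))

/-! ### The universal enveloping superalgebra of `Q(n)` -/

/-- `x y - (-1)^(|x||y|) y x = [x, y]` for homogeneous `x`, `y`. -/
inductive EnvRel (n : ℕ) : TensorAlgebra ℂ (Queer n) → TensorAlgebra ℂ (Queer n) → Prop
  | bracket (a b : ZMod 2) (x y : Queer n) (hx : x ∈ part n a) (hy : y ∈ part n b) :
    EnvRel n
      (TensorAlgebra.ι ℂ x * TensorAlgebra.ι ℂ y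
        - (-1 : ℂ) ^ (a * b).val • (TensorAlgebra.ι ℂ y * TensorAlgebra.ι ℂ x))
      (TensorAlgebra.ι ℂ (x * y - (-1 : ℂ) ^ (a * b).val • (y * x)))

/-- The universal enveloping superalgebra `U(Q(n))`. -/
def Env (n : ℕ) : Type := RingQuot (EnvRel n)

instance (n : ℕ) : Ring (Env n) := inferInstanceAs (Ring (RingQuot (EnvRel n)))

instance (n : ℕ) : Algebra ℂ (Env n) := inferInstanceAs (Algebra ℂ (RingQuot (EnvRel n)))

/-- The canonical map `Q(n) → U(Q(n))`. -/
def ι (n : ℕ) : Queer n →ₗ[ℂ] Env n :=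
  (RingQuot.mkAlgHom ℂ (EnvRel n)).toLinearMap ∘ₗ TensorAlgebra.ι ℂ

/-- The component of parity `d` of `U(Q(n))`. -/
def envPart (n : ℕ) (d : ZMod 2) : Submodule ℂ (Env n) :=
  parityPart (S := {q : ZMod 2 × Queer n // q.2 ∈ part n q.1})
    (fun q => ι n q.1.2) (fun q => q.1.1) d

/-- Sergeev's elements `(e_{i,j}^{(r)}, f_{i,j}^{(r)})` of `U(Q(n))`. The values at `r = 0` are
the convention making `e_{i,j}^{(1)} = e_{i,j}` and `f_{i,j}^{(1)} = f_{i,j}`. -/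
def sergeev {n : ℕ} : ℕ → Fin n → Fin n → Env n × Env n
  | 0 => fun i j => (if i = j then 1 else 0, 0)
  | r + 1 => fun i j =>
    (∑ k, ι n (e i k) * (sergeev r k j).1
        + (-1 : ℂ) ^ (r + 2) • ∑ k, ι n (f i k) * (sergeev r k j).2,
      ∑ k, ι n (e i k) * (sergeev r k j).2
        + (-1 : ℂ) ^ (r + 2) • ∑ k, ι n (f i k) * (sergeev r k j).1)

/-- `e_{i,j}^{(r)}`. -/
def eS {n : ℕ} (r : ℕ) (i j : Fin n) : Env n := (sergeev r i j).1

/-- `f_{i,j}^{(r)}`. -/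
def fS {n : ℕ} (r : ℕ) (i j : Fin n) : Env n := (sergeev r i j).2

/-! ### The finite `W`-algebra -/

/-- The left ideal `I_χ` of `U(Q(n))` generated by `a - χ(a)`, `a ∈ m`
(an `Ideal` of a noncommutative ring is a left ideal). -/
def I (n : ℕ) : Ideal (Env n) :=
  Ideal.span {u | ∃ a ∈ m n, u = ι n a - algebraMap ℂ (Env n) (chi a)}

/-- The elements `y` of `U(Q(n))` with `(a - χ(a)) y ∈ I_χ` for all `a ∈ m`. -/
def whittaker (n : ℕ) : Subalgebra ℂ (Env n) where
  carrier := {y | ∀ a ∈ m n, (ι n a - algebraMap ℂ (Env n) (chi a)) * y ∈ I n}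
  mul_mem' := fun {y z} hy hz a ha => by
    rw [← mul_assoc]
    refine Submodule.span_induction (p := fun u _ => u * z ∈ I n) ?_ ?_ ?_ ?_ (hy a ha)
    · rintro _ ⟨b, hb, rfl⟩
      exact hz b hb
    · simp
    · intro u v _ _ hu hv
      rw [add_mul]
      exact (I n).add_mem hu hv
    · intro c u _ hu
      rw [smul_eq_mul, mul_assoc]
      exact (I n).mul_mem_left c hu
  add_mem' := fun {y z} hy hz a ha => by
    rw [mul_add]
    exact (I n).add_mem (hy a ha) (hz a ha)
  algebraMap_mem' := fun r a ha => by
    rw [← Algebra.commutes]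
    exact (I n).mul_mem_left _ (Submodule.subset_span ⟨a, ha, rfl⟩)

/-- `I_χ` intersected with `whittaker n`, the kernel of `π` there. -/
def whittakerKer (n : ℕ) : Ideal (whittaker n) := (I n).comap (whittaker n).val

instance (n : ℕ) : (whittakerKer n).IsTwoSided where
  mul_mem_of_left := fun {u} z hu => by
    change (u : Env n) * (z : Env n) ∈ I n
    refine Submodule.span_induction (p := fun u _ => u * (z : Env n) ∈ I n) ?_ ?_ ?_ ?_
      (show (u : Env n) ∈ I n from hu)
    · rintro _ ⟨b, hb, rfl⟩
      exact z.2 b hb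
    · simp
    · intro u v _ _ hu hv
      rw [add_mul]
      exact (I n).add_mem hu hv
    · intro c u _ hu
      rw [smul_eq_mul, mul_assoc]
      exact (I n).mul_mem_left c hu

/-- `W_χ = {π(y) ∈ U(Q(n)) / I_χ | (a - χ(a)) y ∈ I_χ for all a ∈ m}` with the product
`π(y) π(z) = π(y z)`. -/
abbrev W (n : ℕ) : Type := whittaker n ⧸ whittakerKer n

/-- The class `π(y)` in `W_χ` of an element `y` as in the definition of `W_χ`. -/
def proj (n : ℕ) : whittaker n →ₐ[ℂ] W n := Ideal.Quotient.mkₐ ℂ (whittakerKer n)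

/-- The component of parity `d` of `W_χ`, induced from `U(Q(n))`. -/
def wPart (n : ℕ) (d : ZMod 2) : Submodule ℂ (W n) :=
  ((envPart n d).comap (whittaker n).val.toLinearMap).map (proj n).toLinearMap

end Queer

/-! ### The super-Yangian `Y(Q(N))` -/

namespace SuperYangian

/-- The indices `±1, …, ±N`: `(a, 0)` is the index `a + 1` and `(a, 1)` is `-(a + 1)`. -/
abbrev Idx (N : ℕ) : Type := Fin N × ZMod 2

/-- The parity of an index. -/
def par {N : ℕ} (i : Idx N) : ZMod 2 := i.2

/-- The index `-i`. -/
def opp {N : ℕ} (i : Idx N) : Idx N := (i.1, i.2 + 1)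

/-- The generators: `(i, j, r)` stands for `T_{i,j}^{(r+1)}`. -/
abbrev Gen (N : ℕ) : Type := Idx N × Idx N × ℕ

/-- The coefficient of `u^{-r}` in `T_{i,j}(u) = δ_{ij} + ∑_{r ≥ 1} T_{i,j}^{(r)} u^{-r}`. -/
def freeT {N : ℕ} (i j : Idx N) : ℤ → FreeAlgebra ℂ (Gen N)
  | Int.ofNat 0 => if i = j then 1 else 0
  | Int.ofNat (r + 1) => FreeAlgebra.ι ℂ (i, j, r)
  | Int.negSucc _ => 0

/-- The supercommutator `[T_{i,j}^{(r)}, T_{k,l}^{(s)}]`. -/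
def freeComm {N : ℕ} (i j : Idx N) (r : ℤ) (k l : Idx N) (s : ℤ) : FreeAlgebra ℂ (Gen N) :=
  freeT i j r * freeT k l s
    - (-1 : ℂ) ^ ((par i + par j) * (par k + par l)).val • (freeT k l s * freeT i j r)

/-- The defining relations. `quad` is the equality of the coefficients of `u^{-r} v^{-s}` in
`(u² - v²) [T_{ij}(u), T_{kl}(v)] (-1)^{p(i)p(k) + p(i)p(l) + p(k)p(l)}
  = (u + v) (T_{kj}(u) T_{il}(v) - T_{kj}(v) T_{il}(u))
    - (u - v) (T_{-k,j}(u) T_{-i,l}(v) - T_{k,-j}(v) T_{i,-l}(u)) (-1)^{p(k) + p(l)}`,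
and `sym` is that of the coefficients of `u^{-r}` in `T_{-i,-j}(u) = T_{i,j}(-u)`. -/
inductive Rel (N : ℕ) : FreeAlgebra ℂ (Gen N) → FreeAlgebra ℂ (Gen N) → Prop
  | quad (i j k l : Idx N) (r s : ℤ) :
    Rel N
      ((-1 : ℂ) ^ (par i * par k + par i * par l + par k * par l).val •
        (freeComm i j (r + 2) k l s - freeComm i j r k l (s + 2)))
      ((freeT k j (r + 1) * freeT i l s + freeT k j r * freeT i l (s + 1)
          - freeT k j s * freeT i l (r + 1) - freeT k j (s + 1) * freeT i l r)
        - (-1 : ℂ) ^ (par k + par l).val •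
          ((freeT (opp k) j (r + 1) * freeT (opp i) l s
              - freeT (opp k) j r * freeT (opp i) l (s + 1))
            - (freeT k (opp j) s * freeT i (opp l) (r + 1)
              - freeT k (opp j) (s + 1) * freeT i (opp l) r)))
  | sym (i j : Idx N) (r : ℕ) :
    Rel N (freeT (opp i) (opp j) r) ((-1 : ℂ) ^ r • freeT i j r)

end SuperYangian

/-- The super-Yangian `Y(Q(N))` of Nazarov and Sergeev. -/
def SuperYangian (N : ℕ) : Type := RingQuot (SuperYangian.Rel N)

namespace SuperYangian

instance (N : ℕ) : Ring (SuperYangian N) := inferInstanceAs (Ring (RingQuot (Rel N)))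

instance (N : ℕ) : Algebra ℂ (SuperYangian N) :=
  inferInstanceAs (Algebra ℂ (RingQuot (Rel N)))

/-- The element `T_{i,j}^{(r)}` of `Y(Q(N))`. -/
def T {N : ℕ} (i j : Idx N) (r : ℕ) : SuperYangian N :=
  RingQuot.mkAlgHom ℂ (Rel N) (freeT i j r)

/-- The component of parity `d` of `Y(Q(N))`, where `T_{i,j}^{(r)}` has parity `p(i) + p(j)`. -/
def yPart (N : ℕ) (d : ZMod 2) : Submodule ℂ (SuperYangian N) :=
  parityPart (S := Gen N) (fun q => T q.1 q.2.1 (q.2.2 + 1)) (fun q => par q.1 + par q.2.1) d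

end SuperYangian

end

noncomputable section

/-! Write `S c r i j` for $e^{(r)}_{i,j}$ ($c=0$) and $f^{(r)}_{i,j}$ ($c=1$): up to signs, the
entries of the $r$-th power of the matrix of generators.

Homomorphism. By `comm_sub_comm`, $[S^{(r+2)},S^{(s)}]-[S^{(r)},S^{(s+2)}]$ is quadratic in the $S$,
in the shape of the Yangian relation. With both index pairs equal to $(n,1)$ only corner elements
occur, and shifting both degrees by $n-1$ preserves the relation. Corner elements are Whittaker
(`S_mem_whittaker`), and modulo $I_\chi$ they vanish below degree $n-1$ and start there with the
constant $1$ or $0$ (`S_sub_mem_I`). So the shifted series has the constant term of $T(u)$, and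
`SuperYangian.lift` applies.

Surjectivity. Let $W'$ be generated by the corner elements. Two facts suffice.

(a) Modulo $I_\chi$, all of $U(\mathfrak g)$ is spanned by products $x_1\cdots x_p w$ with $w\in W'$
and $x_i$ upper triangular basis elements outside the last column (`filtUnion_eq_top`). The last
column is recovered from the recursion for the first column of the $S^{(r)}$.

(b) A Whittaker element of this form lies in $W'+I_\chi$ (`mem_filt_zero_of_mem_whittaker`). Modulo
$I_\chi$ the elements $a-\chi(a)$ act on such products, to leading order, as differences of partial
derivatives in the $x_i$. Combining them gives an Euler operator that multiplies a product by its
length $p$, up to products of lower Kazhdan weight or greater length (`euler_mul_mon`). It kills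
Whittaker elements, so dividing by $p\ge1$ pushes a top-weight part to ever greater length. Length
is at most weight, so that part disappears, and the weight descends to $0$. -/

theorem ZMod.two_cases (c : ZMod 2) : c = 0 ∨ c = 1 := by
  revert c; decide

theorem ZMod.one_add_one_two : (1 + 1 : ZMod 2) = 0 := rfl

/-! ### Signs, the standard basis and its brackets -/

namespace Queer

variable {n : ℕ}

/-- The sign of the interchange of homogeneous elements of parities `c` and `d`. -/
def sg (c d : ZMod 2) : ℂ := (-1 : ℂ) ^ (c * d).val

@[simp] theorem sg_zero_left (d : ZMod 2) : sg 0 d = 1 := by simp [sg]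

@[simp] theorem sg_zero_right (d : ZMod 2) : sg d 0 = 1 := by simp [sg]

@[simp] theorem sg_one_one : sg 1 1 = -1 := by simp [sg, ZMod.val_one]

theorem sg_mul_self (c d : ZMod 2) : sg c d * sg c d = 1 := by
  rcases ZMod.two_cases c with rfl | rfl <;> rcases ZMod.two_cases d with rfl | rfl <;> simp

theorem sg_add_right (c d b : ZMod 2) : sg c (d + b) = sg c d * sg c b := by
  rcases ZMod.two_cases c with rfl | rfl <;> rcases ZMod.two_cases d with rfl | rfl <;>
    rcases ZMod.two_cases b with rfl | rfl <;> simp [ZMod.one_add_one_two]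

theorem sg_comm (c d : ZMod 2) : sg c d = sg d c := by simp [sg, mul_comm]

/-- The standard basis of `Q(n)`: `e_{i,j}` for `c = 0` and `f_{i,j}` for `c = 1`. -/
def basisElt (c : ZMod 2) (i j : Fin n) : Queer n := if c = 0 then e i j else f i j

theorem basisElt_mem_part (c : ZMod 2) (i j : Fin n) : basisElt c i j ∈ part n c := by
  intro a b hab
  rcases ZMod.two_cases c with rfl | rfl <;> rcases a with a | a <;> rcases b with b | b <;>
    simp_all [basisElt, e, f, blockParity, ZMod.one_add_one_two]

theorem basisElt_mul (c d : ZMod 2) (i j k l : Fin n) :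
    basisElt c i j * basisElt d k l = if j = k then basisElt (c + d) i l else 0 := by
  apply Subtype.ext
  by_cases h : j = k
  · subst h
    rcases ZMod.two_cases c with rfl | rfl <;> rcases ZMod.two_cases d with rfl | rfl <;>
      simp [basisElt, e, f, fromBlocks_multiply, ZMod.one_add_one_two]
  · rcases ZMod.two_cases c with rfl | rfl <;> rcases ZMod.two_cases d with rfl | rfl <;>
      simp [basisElt, e, f, fromBlocks_multiply, h]

theorem sum_basisElt (x : Queer n) :
    x = ∑ c : ZMod 2, ∑ i, ∑ j, (x.1 (Sum.inl i) (if c = 0 then Sum.inl j else Sum.inr j)) •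
      basisElt c i j := by
  have key : ∀ A : Matrix (Fin n) (Fin n) ℂ, A = ∑ i, ∑ j, A i j • single i j (1 : ℂ) := by
    intro A
    conv_lhs => rw [matrix_eq_sum_single A]
    simp [smul_single]
  obtain ⟨x, A, B, rfl⟩ := x
  have h : ∀ c : ZMod 2, ((∑ i, ∑ j, (fromBlocks A B B A (Sum.inl i)
      (if c = 0 then Sum.inl j else Sum.inr j)) • basisElt c i j : Queer n) :
      Matrix (Fin n ⊕ Fin n) (Fin n ⊕ Fin n) ℂ) =
      if c = 0 then fromBlocks A 0 0 A else fromBlocks 0 B B 0 := by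
    intro c
    rcases ZMod.two_cases c with rfl | rfl
    · simp only [AddSubmonoidClass.coe_finsetSum, if_true, fromBlocks_apply₁₁]
      ext (a | a) (b | b) <;> simp [Matrix.sum_apply, basisElt, e, single_apply, ite_and]
    · simp only [AddSubmonoidClass.coe_finsetSum, one_ne_zero, if_false, fromBlocks_apply₁₂]
      ext (a | a) (b | b) <;> simp [Matrix.sum_apply, basisElt, f, single_apply, ite_and]
  apply Subtype.ext
  rw [show (Finset.univ : Finset (ZMod 2)) = {0, 1} from rfl, Finset.sum_pair (by decide)]
  change _ = ((∑ i, ∑ j, (fromBlocks A B B A (Sum.inl i)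
      (if (0 : ZMod 2) = 0 then Sum.inl j else Sum.inr j)) • basisElt 0 i j : Queer n) :
      Matrix (Fin n ⊕ Fin n) (Fin n ⊕ Fin n) ℂ) + ((∑ i, ∑ j, (fromBlocks A B B A (Sum.inl i)
      (if (1 : ZMod 2) = 0 then Sum.inl j else Sum.inr j)) • basisElt 1 i j : Queer n) :
      Matrix (Fin n ⊕ Fin n) (Fin n ⊕ Fin n) ℂ)
  rw [h, h]
  simp [fromBlocks_add]

/-- The image of a standard basis element in `U(Q(n))`. -/
def X (c : ZMod 2) (i j : Fin n) : Env n := ι n (basisElt c i j)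

theorem ι_bracket (a b : ZMod 2) (x y : Queer n) (hx : x ∈ part n a) (hy : y ∈ part n b) :
    ι n x * ι n y - sg a b • (ι n y * ι n x) = ι n (x * y - sg a b • (y * x)) := by
  have h := RingQuot.mkAlgHom_rel ℂ (EnvRel.bracket a b x y hx hy)
  rw [map_sub, map_smul, map_mul, map_mul] at h
  exact h

theorem X_mul_X (c d : ZMod 2) (i j k l : Fin n) :
    X c i j * X d k l = sg c d • (X d k l * X c i j) + (if j = k then X (c + d) i l else 0)
      - sg c d • (if i = l then X (c + d) k j else 0) := by
  have h := ι_bracket c d _ _ (basisElt_mem_part c i j) (basisElt_mem_part d k l)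
  rw [basisElt_mul, basisElt_mul, map_sub, map_smul, apply_ite (ι n), apply_ite (ι n), map_zero,
    add_comm d c] at h
  unfold X
  rw [sub_eq_iff_eq_add] at h
  rw [h]
  simp only [eq_comm (a := l) (b := i)]
  abel

/-! ### Sergeev's elements: adjoint action and products -/

/-- The elements `e_{i,j}^{(m)}` for `c = 0` and `f_{i,j}^{(m)}` for `c = 1`. -/
def S (c : ZMod 2) (m : ℕ) (i j : Fin n) : Env n := if c = 0 then eS m i j else fS m i j

theorem S_zero_zero (i j : Fin n) : S 0 0 i j = if i = j then (1 : Env n) else 0 := rfl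

theorem S_one_zero (i j : Fin n) : S 1 0 i j = (0 : Env n) := rfl

theorem S_succ (c : ZMod 2) (m : ℕ) (i j : Fin n) :
    S c (m + 1) i j = ∑ k, X 0 i k * S c m k j
      + (-1 : ℂ) ^ m • ∑ k, X 1 i k * S (c + 1) m k j := by
  have h2 : (-1 : ℂ) ^ (m + 2) = (-1) ^ m := by rw [pow_add]; norm_num
  rcases ZMod.two_cases c with rfl | rfl
  · simp only [S, eS, sergeev, h2]; rfl
  · simp only [S, fS, sergeev, h2]; rfl

/-- Inductive step of `X_mul_S` for one parity `b` of the recursion. The two terms in `X _ k j` are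
byproducts that cancel once `b = 0` and `b = 1` are added. -/
theorem X_mul_S_aux (d b c : ZMod 2) (m : ℕ) (i j k l : Fin n)
    (ih : ∀ (c : ZMod 2) (k : Fin n), X d i j * S c m k l = sg d c • (S c m k l * X d i j)
      + (sg d 1 ^ (m + 1) • (if j = k then S (c + d) m i l else 0)
      - sg d c • (if i = l then S (c + d) m k j else 0))) :
    X d i j * ∑ a, X b k a * S c m a l = (sg d b * sg d c) • ((∑ a, X b k a * S c m a l) * X d i j)
      + (if j = k then ∑ a, X (d + b) i a * S c m a l else 0)
      - sg d b • (X (d + b) k j * S c m i l)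
      + (sg d b * sg d 1 ^ (m + 1)) • (X b k j * S (c + d) m i l)
      - (sg d b * sg d c) • (if i = l then ∑ a, X b k a * S (c + d) m a j else 0) := by
  have step : ∀ a, X d i j * (X b k a * S c m a l) =
      (sg d b * sg d c) • (X b k a * S c m a l * X d i j)
      + (if j = k then X (d + b) i a * S c m a l else 0)
      - sg d b • (if i = a then X (d + b) k j * S c m a l else 0)
      + (sg d b * sg d 1 ^ (m + 1)) • (if j = a then X b k a * S (c + d) m i l else 0)
      - (sg d b * sg d c) • (if i = l then X b k a * S (c + d) m a j else 0) := by
    intro a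
    rw [← mul_assoc, X_mul_X, sub_mul, add_mul, smul_mul_assoc, mul_assoc (X b k a), ih]
    simp only [mul_add, mul_sub, mul_smul_comm, smul_add, smul_sub, smul_mul_assoc, ite_mul,
      mul_ite, mul_zero, zero_mul, smul_smul, mul_assoc]
    abel
  rw [Finset.mul_sum, Finset.sum_congr rfl fun a _ => step a]
  simp only [Finset.sum_add_distrib, Finset.sum_sub_distrib, ← Finset.smul_sum, Finset.sum_mul,
    Finset.sum_ite_eq, Finset.mem_univ, if_true]
  split_ifs <;> simp

theorem X_mul_S (d c : ZMod 2) (m : ℕ) (i j k l : Fin n) :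
    X d i j * S c m k l = sg d c • (S c m k l * X d i j)
      + (sg d 1 ^ (m + 1) • (if j = k then S (c + d) m i l else 0)
      - sg d c • (if i = l then S (c + d) m k j else 0)) := by
  induction m generalizing c k with
  | zero =>
    rcases ZMod.two_cases c with rfl | rfl <;> rcases ZMod.two_cases d with rfl | rfl <;>
      simp [S_zero_zero, S_one_zero, ZMod.one_add_one_two] <;> split_ifs <;> simp_all
  | succ m ih =>
    rw [S_succ, mul_add, mul_smul_comm, X_mul_S_aux d 0 c m i j k l ih,
      X_mul_S_aux d 1 (c + 1) m i j k l ih, S_succ, S_succ]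
    rcases neg_one_pow_eq_or ℂ m with h | h <;>
    rcases ZMod.two_cases c with rfl | rfl <;> rcases ZMod.two_cases d with rfl | rfl <;>
      by_cases h1 : j = k <;> by_cases h2 : i = l <;>
      simp [h, h1, h2, ZMod.one_add_one_two, add_mul, pow_succ] <;> abel


/-- The law of exponents for powers of the matrix of generators. It collapses the contracted sums in
`comm_succ` to single elements. -/
theorem sum_S_mul_S (c' c : ZMod 2) (s r : ℕ) (k j : Fin n) :
    ∑ a, S c' s k a * S c r a j + (-1 : ℂ) ^ r • ∑ a, S (c' + 1) s k a * S (c + 1) r a j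
      = sg c' 1 ^ r • S (c + c') (s + r) k j := by
  induction s generalizing c' k with
  | zero =>
    rcases ZMod.two_cases c' with rfl | rfl <;>
      simp [S_zero_zero, S_one_zero, ZMod.one_add_one_two]
  | succ s ih =>
    have h : ∀ (c' c : ZMod 2), ∑ a, S c' (s + 1) k a * S c r a j =
        ∑ b, X 0 k b * (∑ a, S c' s b a * S c r a j)
        + (-1 : ℂ) ^ s • ∑ b, X 1 k b * (∑ a, S (c' + 1) s b a * S c r a j) := by
      intro c' c
      simp only [S_succ, add_mul, smul_mul_assoc, Finset.sum_add_distrib, Finset.sum_mul,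
        Finset.mul_sum, Finset.smul_sum, mul_assoc]
      congr 1
      · exact Finset.sum_comm
      · exact Finset.sum_comm
    have h1 : c' + 1 + 1 = c' := by rw [add_assoc, ZMod.one_add_one_two, add_zero]
    have h2 : c + 1 + 1 = c := by rw [add_assoc, ZMod.one_add_one_two, add_zero]
    have e1 : ∑ a, S c' (s + 1) k a * S c r a j +
        (-1 : ℂ) ^ r • ∑ a, S (c' + 1) (s + 1) k a * S (c + 1) r a j =
        ∑ b, X 0 k b * (∑ a, S c' s b a * S c r a j
          + (-1 : ℂ) ^ r • ∑ a, S (c' + 1) s b a * S (c + 1) r a j)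
        + (-1 : ℂ) ^ s • ∑ b, X 1 k b * (∑ a, S (c' + 1) s b a * S c r a j
          + (-1 : ℂ) ^ r • ∑ a, S (c' + 1 + 1) s b a * S (c + 1) r a j) := by
      rw [h, h]
      simp only [mul_add, mul_smul_comm, Finset.sum_add_distrib, ← Finset.smul_sum, smul_add]
      rw [smul_comm ((-1 : ℂ) ^ r)]
      abel
    rw [e1]
    simp only [ih]
    rw [add_right_comm s 1 r, S_succ]
    rcases neg_one_pow_eq_or ℂ r with h | h <;> rcases neg_one_pow_eq_or ℂ s with h' | h' <;>
    rcases ZMod.two_cases c' with rfl | rfl <;> rcases ZMod.two_cases c with rfl | rfl <;>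
      simp [h, h', ZMod.one_add_one_two, pow_add]

/-! ### Quadratic relations between Sergeev's elements -/

/-- The supercommutator of two of the elements `S c r i j`. -/
def comm (c c' : ZMod 2) (r s : ℕ) (i j k l : Fin n) : Env n :=
  S c r i j * S c' s k l - sg c c' • (S c' s k l * S c r i j)

/-- The quadratic expressions in which the supercommutators of the elements `S c r i j` expand. -/
def quadTerm (c c' : ZMod 2) (r p q : ℕ) (i j k l : Fin n) : Env n :=
  sg c c' • (S c' p i l * S c q k j)
    + ((-1 : ℂ) ^ (r + p) * sg (c + 1) c') • (S (c' + 1) p i l * S (c + 1) q k j)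

/-- One step of the recursion for the elements `S c r i j`. -/
def lstep (r : ℕ) (F : ZMod 2 → Fin n → Env n) (c : ZMod 2) (i : Fin n) : Env n :=
  ∑ a, X 0 i a * F c a + (-1 : ℂ) ^ r • ∑ a, X 1 i a * F (c + 1) a

theorem lstep_add (r : ℕ) (F G : ZMod 2 → Fin n → Env n) (c : ZMod 2) (i : Fin n) :
    lstep r (fun c a => F c a + G c a) c i = lstep r F c i + lstep r G c i := by
  simp only [lstep, mul_add, Finset.sum_add_distrib, smul_add]
  abel

theorem lstep_sub (r : ℕ) (F G : ZMod 2 → Fin n → Env n) (c : ZMod 2) (i : Fin n) :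
    lstep r (fun c a => F c a - G c a) c i = lstep r F c i - lstep r G c i := by
  simp only [lstep, mul_sub, Finset.sum_sub_distrib, smul_sub]
  abel

theorem quadTerm_add_two (c c' : ZMod 2) (r p q : ℕ) (i j k l : Fin n) :
    quadTerm c c' (r + 2) p q i j k l = quadTerm c c' r p q i j k l := by
  simp [quadTerm, pow_add]

theorem lstep_quadTerm (c c' : ZMod 2) (r p q : ℕ) (i j k l : Fin n) :
    lstep r (fun c a => quadTerm c c' r p q a j k l) c i
      = quadTerm c c' (r + 1) (p + 1) q i j k l := by
  rw [quadTerm, S_succ, S_succ]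
  simp only [lstep, quadTerm, mul_add, add_mul, mul_smul_comm, smul_mul_assoc,
    Finset.sum_add_distrib, ← Finset.smul_sum, smul_add, Finset.sum_mul, mul_assoc]
  rcases neg_one_pow_eq_or ℂ r with hr | hr <;> rcases neg_one_pow_eq_or ℂ p with hp | hp <;>
  rcases ZMod.two_cases c' with rfl | rfl <;> rcases ZMod.two_cases c with rfl | rfl <;>
    simp [hr, hp, ZMod.one_add_one_two, pow_add] <;> abel

/-- Expand `S c (r + 1) i j` by its recursion and move `X` past `S c' s k l` with `X_mul_S`. The
term with `a = k` gives the first quadratic expression; the term with `i = l` is a contracted sum,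
which `sum_S_mul_S` turns into the second. -/
theorem comm_succ (c c' : ZMod 2) (r s : ℕ) (i j k l : Fin n) :
    comm c c' (r + 1) s i j k l = lstep r (fun c a => comm c c' r s a j k l) c i
      + quadTerm c c' (r + 1) s r i j k l - quadTerm c c' (r + 1) 0 (s + r) i j k l := by
  have h : ∀ d a, X d i a * S (c + d) r a j * S c' s k l =
      sg c c' • (S c' s k l * (X d i a * S (c + d) r a j))
      + X d i a * comm (c + d) c' r s a j k l
      + (sg (c + d) c' * sg d 1 ^ (s + 1)) •
        (if a = k then S (c' + d) s i l * S (c + d) r a j else 0)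
      - sg c c' • (if i = l then S (c' + d) s k a * S (c + d) r a j else 0) := by
    intro d a
    have hs : sg (c + d) c' * sg d c' = sg c c' := by
      rw [sg_comm (c + d), sg_add_right, sg_comm d, mul_assoc, sg_mul_self, mul_one, sg_comm]
    have e1 : S (c + d) r a j * S c' s k l =
      comm (c + d) c' r s a j k l + sg (c + d) c' • (S c' s k l * S (c + d) r a j) := by
      rw [comm, sub_add_cancel]
    rw [mul_assoc, e1, mul_add, mul_smul_comm, ← mul_assoc (X d i a) (S c' s k l), X_mul_S]
    simp only [add_mul, sub_mul, smul_mul_assoc, smul_add, smul_sub, smul_smul, ite_mul, zero_mul,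
      hs, mul_assoc]
    abel
  have h0 := fun a => h 0 a
  have h1 := fun a => h 1 a
  clear h
  simp only [add_zero] at h0
  rw [comm, S_succ, add_mul, smul_mul_assoc, Finset.sum_mul, Finset.sum_mul,
    Finset.sum_congr rfl fun a _ => h0 a, Finset.sum_congr rfl fun a _ => h1 a]
  simp only [lstep, Finset.sum_add_distrib, Finset.sum_sub_distrib, ← Finset.smul_sum, mul_add,
    Finset.mul_sum, mul_smul_comm, smul_add, smul_sub, Finset.sum_ite_eq', Finset.mem_univ, if_true]
  have hm := sum_S_mul_S c' c s r k j
  have hp : quadTerm c c' (r + 1) 0 (s + r) i j k l = (sg c c') •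
      (if i = l then sg c' 1 ^ r • S (c + c') (s + r) k j else 0) := by
    rcases ZMod.two_cases c' with rfl | rfl <;> rcases ZMod.two_cases c with rfl | rfl <;>
      simp [quadTerm, S_zero_zero, S_one_zero, ZMod.one_add_one_two, pow_add]
  rw [hp, ← hm, quadTerm]
  clear h0 h1 hp hm
  by_cases hil : i = l <;>
  rcases neg_one_pow_eq_or ℂ r with hr | hr <;> rcases neg_one_pow_eq_or ℂ s with hs | hs <;>
  rcases ZMod.two_cases c' with rfl | rfl <;> rcases ZMod.two_cases c with rfl | rfl <;>
    simp [hr, hs, hil, ZMod.one_add_one_two, pow_add] <;> abel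

theorem comm_zero_left (c c' : ZMod 2) (s : ℕ) (i j k l : Fin n) :
    comm c c' 0 s i j k l = 0 := by
  rcases ZMod.two_cases c with rfl | rfl <;> by_cases h : i = j <;>
    simp [comm, S_zero_zero, S_one_zero, h]

theorem comm_zero_right (c c' : ZMod 2) (r : ℕ) (i j k l : Fin n) :
    comm c c' r 0 i j k l = 0 := by
  rcases ZMod.two_cases c' with rfl | rfl <;> by_cases h : k = l <;>
    simp [comm, S_zero_zero, S_one_zero, h]

theorem comm_one_left (c c' : ZMod 2) (s : ℕ) (i j k l : Fin n) :
    comm c c' 1 s i j k l = quadTerm c c' 1 s 0 i j k l - quadTerm c c' 1 0 s i j k l := by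
  rw [← zero_add 1, comm_succ]
  simp [lstep, comm_zero_left]

theorem comm_one_right (c c' : ZMod 2) (r : ℕ) (i j k l : Fin n) :
    comm c c' r 1 i j k l = quadTerm c c' r r 0 i j k l - quadTerm c c' r 0 r i j k l := by
  have h : comm c c' r 1 i j k l = -(sg c c' • comm c' c 1 r k l i j) := by
    rw [comm, comm, smul_sub, smul_smul, sg_comm c' c, sg_mul_self, one_smul, neg_sub]
  rw [h, comm_one_left]
  rcases ZMod.two_cases c with rfl | rfl <;> rcases ZMod.two_cases c' with rfl | rfl <;>
  by_cases h1 : k = j <;> by_cases h2 : i = l <;>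
  rcases neg_one_pow_eq_or ℂ r with hr | hr <;>
    simp [quadTerm, h1, h2, S_zero_zero, S_one_zero, hr, pow_add, ZMod.one_add_one_two,
      sub_eq_add_neg]

/-- The contracted terms that `comm_succ` produces for `(r + 3, s)` and `(r + 1, s + 2)` have the
same total degree, so they cancel in the difference. The shift is by two because the signs depend on
the parity of `r`. -/
theorem comm_sub_comm (c c' : ZMod 2) (r s : ℕ) (i j k l : Fin n) :
    comm c c' (r + 2) s i j k l - comm c c' r (s + 2) i j k l =
      quadTerm c c' r s (r + 1) i j k l + quadTerm c c' r (s + 1) r i j k l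
        - quadTerm c c' r r (s + 1) i j k l - quadTerm c c' r (r + 1) s i j k l := by
  induction r generalizing c i with
  | zero =>
    rw [comm_zero_left, comm_succ]
    simp only [comm_one_left, lstep_sub, lstep_quadTerm, zero_add, quadTerm_add_two, Nat.reduceAdd]
    abel
  | succ r ih =>
    have hl : ∀ F : ZMod 2 → Fin n → Env n, lstep (r + 2) F = lstep r F := by
      intro F; ext c i; simp [lstep, pow_add]
    rw [show r + 1 + 2 = r + 2 + 1 from rfl, comm_succ, comm_succ, hl]
    have := lstep_sub r (fun c a => comm c c' (r + 2) s a j k l)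
      (fun c a => comm c c' r (s + 2) a j k l) c i
    simp only [ih, lstep_sub, lstep_add, lstep_quadTerm] at this
    rw [eq_comm, sub_eq_iff_eq_add] at this
    rw [this, show r + 2 + 1 = r + 1 + 2 from rfl, quadTerm_add_two, quadTerm_add_two,
      show s + 2 + r = s + (r + 2) by ring]
    abel

/-! ### Extension of the relations to integral degrees -/

/-- The elements `S c m i j`, extended by zero to negative `m`. -/
def SZ (c : ZMod 2) (m : ℤ) (i j : Fin n) : Env n := if 0 ≤ m then S c m.toNat i j else 0

theorem SZ_natCast (c : ZMod 2) (m : ℕ) (i j : Fin n) : SZ c m i j = S c m i j := by simp [SZ]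

theorem SZ_of_neg (c : ZMod 2) {m : ℤ} (hm : m < 0) (i j : Fin n) : SZ c m i j = 0 := by
  simp [SZ, hm]

/-- The analogue of `quadTerm` for integral exponents. -/
def quadTermZ (c c' : ZMod 2) (r p q : ℤ) (i j k l : Fin n) : Env n :=
  sg c c' • (SZ c' p i l * SZ c q k j)
    + ((-1 : ℂ) ^ (r + p) * sg (c + 1) c') • (SZ (c' + 1) p i l * SZ (c + 1) q k j)

/-- The analogue of `comm` for integral exponents. -/
def commZ (c c' : ZMod 2) (r s : ℤ) (i j k l : Fin n) : Env n :=
  SZ c r i j * SZ c' s k l - sg c c' • (SZ c' s k l * SZ c r i j)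

theorem quadTermZ_natCast (c c' : ZMod 2) (r p q : ℕ) (i j k l : Fin n) :
    quadTermZ c c' r p q i j k l = quadTerm c c' r p q i j k l := by
  simp only [quadTermZ, quadTerm, SZ_natCast]
  norm_cast

theorem quadTermZ_of_neg (c c' : ZMod 2) (r p q : ℤ) (i j k l : Fin n) (h : p < 0 ∨ q < 0) :
    quadTermZ c c' r p q i j k l = 0 := by
  rcases h with h | h <;> simp [quadTermZ, SZ_of_neg _ h]

theorem quadTermZ_add_two (c c' : ZMod 2) (r p q : ℤ) (i j k l : Fin n) :
    quadTermZ c c' (r + 2) p q i j k l = quadTermZ c c' r p q i j k l := by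
  rw [quadTermZ, quadTermZ, add_right_comm, zpow_add₀ (by norm_num) (r + p)]
  norm_num

theorem commZ_natCast (c c' : ZMod 2) (r s : ℕ) (i j k l : Fin n) :
    commZ c c' r s i j k l = comm c c' r s i j k l := by
  simp only [commZ, comm, SZ_natCast]

theorem commZ_of_neg (c c' : ZMod 2) (r s : ℤ) (i j k l : Fin n) (h : r < 0 ∨ s < 0) :
    commZ c c' r s i j k l = 0 := by
  rcases h with h | h <;> simp [commZ, SZ_of_neg _ h]

/-- Negative degrees matter: the Yangian relations are indexed by all integers, and they are later
shifted by `n - 1`. The boundary cases `r = -1` and `s = -1` are the brackets with degree-one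
elements; for `-2` only brackets with degree-zero scalars remain. -/
theorem commZ_sub_commZ (c c' : ZMod 2) (r s : ℤ) (i j k l : Fin n) :
    commZ c c' (r + 2) s i j k l - commZ c c' r (s + 2) i j k l =
      quadTermZ c c' r s (r + 1) i j k l + quadTermZ c c' r (s + 1) r i j k l
        - quadTermZ c c' r r (s + 1) i j k l - quadTermZ c c' r (r + 1) s i j k l := by
  obtain h | rfl | rfl | h : r ≤ -3 ∨ r = -2 ∨ r = -1 ∨ 0 ≤ r := by omega
  · simp (disch := omega) only [quadTermZ_of_neg, commZ_of_neg]
    simp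
  · have h0 : commZ c c' (-2 + 2) s i j k l = 0 := by
      by_cases hs : 0 ≤ s
      · lift s to ℕ using hs
        exact (commZ_natCast c c' 0 s i j k l).trans (comm_zero_left ..)
      · exact commZ_of_neg _ _ _ _ _ _ _ _ (by omega)
    simp (disch := omega) only [h0, quadTermZ_of_neg, commZ_of_neg]
    simp
  · rw [← quadTermZ_add_two c c' (-1) s, ← quadTermZ_add_two c c' (-1) (-1 + 1)]
    simp (disch := omega) only [quadTermZ_of_neg c c' (-1), commZ_of_neg c c' (-1)]
    by_cases hs : 0 ≤ s
    · lift s to ℕ using hs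
      have h1 := (commZ_natCast c c' 1 s i j k l).trans (comm_one_left ..)
      have h2 := quadTermZ_natCast c c' 1 s 0 i j k l
      have h3 := quadTermZ_natCast c c' 1 0 s i j k l
      norm_num at h1 h2 h3 ⊢
      rw [h1, h2, h3]
    · simp (disch := omega) only [quadTermZ_of_neg, commZ_of_neg]
      simp
  · lift r to ℕ using h
    obtain h | rfl | rfl | h : s ≤ -3 ∨ s = -2 ∨ s = -1 ∨ 0 ≤ s := by omega
    · simp (disch := omega) only [quadTermZ_of_neg, commZ_of_neg]
      simp
    · have h0 : commZ c c' r (-2 + 2) i j k l = 0 :=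
        (commZ_natCast c c' r 0 i j k l).trans (comm_zero_right ..)
      simp (disch := omega) only [h0, quadTermZ_of_neg, commZ_of_neg]
      simp
    · simp (disch := omega) only [quadTermZ_of_neg c c' _ _ (-1), quadTermZ_of_neg c c' _ (-1),
        commZ_of_neg c c' _ (-1)]
      have h1 := (commZ_natCast c c' r 1 i j k l).trans (comm_one_right ..)
      have h2 := quadTermZ_natCast c c' r r 0 i j k l
      have h3 := quadTermZ_natCast c c' r 0 r i j k l
      norm_num at h1 h2 h3 ⊢
      rw [h1, h2, h3]
      abel
    · lift s to ℕ using h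
      exact_mod_cast comm_sub_comm c c' r s i j k l


/-! ### The subalgebra `m`, the ideal `I_χ` and Whittaker elements -/

theorem h_mul_basisElt (c : ZMod 2) (i j : Fin n) :
    h n * basisElt c i j = ((n : ℂ) - 1 - 2 * (i : ℕ)) • basisElt c i j := by
  simp only [h, Finset.sum_mul, smul_mul_assoc, show ∀ i j, e i j = basisElt (n := n) 0 i j from
    fun _ _ => rfl, basisElt_mul, zero_add]
  simp

theorem basisElt_mul_h (c : ZMod 2) (i j : Fin n) :
    basisElt c i j * h n = ((n : ℂ) - 1 - 2 * (j : ℕ)) • basisElt c i j := by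
  simp only [h, Finset.mul_sum, mul_smul_comm, show ∀ i j, e i j = basisElt (n := n) 0 i j from
    fun _ _ => rfl, basisElt_mul, add_zero]
  simp

theorem h_val (n : ℕ) : (h n).1 = fromBlocks (diagonal fun i : Fin n => (n : ℂ) - 1 - 2 * (i : ℕ))
    0 0 (diagonal fun i : Fin n => (n : ℂ) - 1 - 2 * (i : ℕ)) := by
  simp only [h, AddSubmonoidClass.coe_finsetSum]
  ext (a | a) (b | b) <;> simp [Matrix.sum_apply, e, single_apply, diagonal_apply, ite_and]

/-- The value of `χ` at a standard basis element. -/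
def chiVal (c : ZMod 2) (i j : ℕ) : ℂ := if c = 0 ∧ i = j + 1 then 1 else 0

theorem chi_basisElt (c : ZMod 2) (i j : Fin n) : chi (basisElt c i j) = chiVal c i j := by
  simp only [chi, E, Finset.mul_sum, mul_ite, mul_zero, show ∀ i j, f i j = basisElt (n := n) 1 i j
    from fun _ _ => rfl, basisElt_mul]
  have hsum : (∑ a : Fin n, ∑ b : Fin n, if (b : ℕ) = a + 1 then
      if j = a then basisElt (c + 1) i b else 0 else 0 : Queer n) =
      ∑ b : Fin n, if (b : ℕ) = j + 1 then basisElt (c + 1) i b else 0 := by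
    rw [Finset.sum_comm]
    refine Finset.sum_congr rfl fun b _ => ?_
    rw [Finset.sum_eq_single j]
    · simp
    · intro a _ ha
      simp [ha.symm]
    · simp
  rw [hsum]
  have hlin : ∀ F : Fin n → Queer n, otr (∑ b, F b) = ∑ b, otr (F b) := by
    intro F
    simp only [otr, AddSubmonoidClass.coe_finsetSum, trace, diag, toBlocks₁₂, of_apply,
      Matrix.sum_apply]
    exact Finset.sum_comm
  have hval : ∀ b : Fin n, otr (basisElt (c + 1) i b) = if c = 0 ∧ i = b then 1 else 0 := by
    intro b
    rcases ZMod.two_cases c with rfl | rfl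
    · by_cases hib : i = b
      · subst hib; simp [otr, basisElt, f]
      · simp [otr, basisElt, f, hib]
    · simp [otr, basisElt, e, ZMod.one_add_one_two, toBlocks₁₂, trace]
  have h0 : otr (0 : Queer n) = 0 := by simp [otr, toBlocks₁₂, trace]
  rw [hlin, chiVal]
  simp only [apply_ite otr, hval, h0]
  by_cases hc : c = 0
  · simp only [hc, true_and]
    by_cases hij : (i : ℕ) = j + 1
    · rw [Finset.sum_eq_single i] <;> simp +contextual [hij, eq_comm]
    · rw [if_neg hij]
      refine Finset.sum_eq_zero fun b _ => ?_
      split_ifs with h1 h2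
      · exact absurd (h2 ▸ h1) hij
      · rfl
      · rfl
  · simp [hc]

theorem basisElt_mem_m (c : ZMod 2) (i j : Fin n) (hij : j < i) : basisElt c i j ∈ m n := by
  have hij' : (j : ℕ) < i := hij
  refine Submodule.mem_iSup_of_mem ((i : ℕ) - j) (Submodule.mem_iSup_of_mem
    (Finset.mem_Icc.2 ⟨by omega, by omega⟩) ?_)
  change h n * _ - _ * h n = _
  rw [h_mul_basisElt, basisElt_mul_h, ← sub_smul]
  congr 1
  push_cast [Nat.cast_sub hij'.le]
  ring

theorem m_le_span : m n ≤ Submodule.span ℂ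
    {x | ∃ (c : ZMod 2) (i j : Fin n), j < i ∧ x = basisElt c i j} := by
  refine iSup₂_le fun d hd x hx => ?_
  have hx' : h n * x - x * h n = ((-2 * (d : ℤ) : ℤ) : ℂ) • x := hx
  rw [sum_basisElt x]
  refine Submodule.sum_mem _ fun c _ => Submodule.sum_mem _ fun i _ => Submodule.sum_mem _
    fun j _ => ?_
  by_cases hij : j < i
  · exact Submodule.smul_mem _ _ (Submodule.subset_span ⟨c, i, j, hij, rfl⟩)
  · have hz : x.1 (Sum.inl i) (if c = 0 then Sum.inl j else Sum.inr j) = 0 := by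
      have h1 := congrArg (fun y : Queer n => y.1 (Sum.inl i)
        (if c = 0 then Sum.inl j else Sum.inr j)) hx'
      change ((h n).1 * x.1 - x.1 * (h n).1) _ _ = _ * x.1 _ _ at h1
      obtain ⟨x, A, B, rfl⟩ := x
      rw [h_val] at h1
      -- The `(i, j)` entry has eigenvalue `2 * (j - i)`, which is nonnegative for `i ≤ j`, so it
      -- cannot equal `-2 * d` with `d ≥ 1`.
      have key : ∀ t : ℂ, ((n : ℂ) - 1 - 2 * (i : ℕ)) * t - t * ((n : ℂ) - 1 - 2 * (j : ℕ)) =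
          ((-2 * (d : ℤ) : ℤ) : ℂ) * t → t = 0 := by
        intro t ht
        have h2 : (((j : ℤ) - i + d : ℤ) : ℂ) * t = 0 := by
          push_cast at ht ⊢
          linear_combination ht / 2
        rcases mul_eq_zero.1 h2 with h3 | h3
        · have h4 : ((j : ℕ) : ℤ) - (i : ℕ) + d = 0 := by exact_mod_cast h3
          have h5 := (Finset.mem_Icc.1 hd).1
          have h6 : (i : ℕ) ≤ j := not_lt.1 hij
          omega
        · exact h3
      rcases ZMod.two_cases c with rfl | rfl
      · refine key _ ?_
        simpa [fromBlocks_multiply, diagonal_mul, mul_diagonal] using h1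
      · refine key _ ?_
        simpa [fromBlocks_multiply, diagonal_mul, mul_diagonal] using h1
    rw [hz, zero_smul]
    exact Submodule.zero_mem _

/-- The generators `a - χ(a)` of `I_χ`, `a` a standard basis element of `m`. -/
def Z (c : ZMod 2) (i j : Fin n) : Env n := X c i j - algebraMap ℂ (Env n) (chiVal c i j)

theorem Z_mem_I (c : ZMod 2) (i j : Fin n) (hij : j < i) : Z c i j ∈ I n :=
  Submodule.subset_span ⟨_, basisElt_mem_m c i j hij, by rw [chi_basisElt]; rfl⟩

theorem mem_whittaker (y : Env n) (hy : ∀ (c : ZMod 2) (i j : Fin n), j < i → Z c i j * y ∈ I n) :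
    y ∈ whittaker n := by
  intro a ha
  have hchi : ∀ x z : Queer n, chi (x + z) = chi x + chi z := by
    intro x z
    simp [chi, add_mul, otr, toBlocks₁₂, trace, Finset.sum_add_distrib]
  have hsmul : ∀ (t : ℂ) (x : Queer n), chi (t • x) = t * chi x := by
    intro t x
    simp [chi, otr, toBlocks₁₂, trace, Finset.mul_sum]
  have ha' := m_le_span ha
  clear ha
  induction ha' using Submodule.span_induction with
  | mem x hx =>
    obtain ⟨c, i, j, hij, rfl⟩ := hx
    rw [chi_basisElt]
    exact hy c i j hij
  | zero =>
    have : chi (0 : Queer n) = 0 := by simpa using hsmul 0 0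
    simp [this]
  | add x z _ _ hx hz =>
    rw [map_add, hchi, map_add, add_sub_add_comm, add_mul]
    exact add_mem hx hz
  | smul t x _ hx =>
    have : (ι n (t • x) - algebraMap ℂ (Env n) (chi (t • x))) * y =
        algebraMap ℂ (Env n) t * ((ι n x - algebraMap ℂ (Env n) (chi x)) * y) := by
      rw [map_smul, hsmul, map_mul, ← mul_assoc, mul_sub, Algebra.smul_def]
    rw [this]
    exact (I n).mul_mem_left _ hx

theorem Z_mul_mem_I {y : Env n} (hy : y ∈ whittaker n) (c : ZMod 2) (i j : Fin n) (hij : j < i) :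
    Z c i j * y ∈ I n := by
  have := hy _ (basisElt_mem_m c i j hij)
  rwa [chi_basisElt] at this

theorem I_mul_mem_I {u y : Env n} (hu : u ∈ I n) (hy : y ∈ whittaker n) : u * y ∈ I n := by
  refine Submodule.span_induction (p := fun u _ => u * y ∈ I n) ?_ ?_ ?_ ?_ hu
  · rintro _ ⟨a, ha, rfl⟩
    exact hy a ha
  · simp
  · intro u v _ _ hu hv
    rw [add_mul]
    exact (I n).add_mem hu hv
  · intro c u _ hu
    rw [smul_eq_mul, mul_assoc]
    exact (I n).mul_mem_left c hu

theorem smul_mem_I {u : Env n} (t : ℂ) (hu : u ∈ I n) : t • u ∈ I n := by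
  rw [Algebra.smul_def]
  exact (I n).mul_mem_left _ hu

/-- Since `χ` vanishes on odd elements, its constants carry no sign, and `Z` supercommutes exactly
as `X` does. -/
theorem sg_mul_chiVal (c d : ZMod 2) (i j : ℕ) : sg c d * chiVal c i j = chiVal c i j := by
  rcases ZMod.two_cases c with rfl | rfl <;> simp [chiVal]

/-- For `j < i`, neither `j` is the last row nor `i` the first column, so both terms of the bracket
in `X_mul_S` vanish and `Z` passes to the right, into `I_χ`. -/
theorem S_mem_whittaker (c : ZMod 2) (r : ℕ) (k l : Fin n) (hk : (k : ℕ) + 1 = n)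
    (hl : (l : ℕ) = 0) : S c r k l ∈ whittaker n := by
  refine mem_whittaker _ fun d i j hij => ?_
  have hij' : (j : ℕ) < i := hij
  have h1 : j ≠ k := by rintro rfl; omega
  have h2 : i ≠ l := by rintro rfl; omega
  have : Z d i j * S c r k l = sg d c • (S c r k l * Z d i j) := by
    rw [Z, sub_mul, X_mul_S, mul_sub, smul_sub, ← Algebra.commutes, ← Algebra.smul_def, smul_smul,
      sg_mul_chiVal, if_neg h1, if_neg h2]
    simp
  rw [this]
  exact smul_mem_I _ ((I n).mul_mem_left _ (Z_mem_I d i j hij))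

theorem X_mul_S_sub_mem_I (d c : ZMod 2) (r : ℕ) (i k l : Fin n) (hl : (l : ℕ) = 0)
    (hki : k < i) : X d i k * S c r k l -
      (chiVal d i k • S c r k l + sg d 1 ^ (r + 1) • S (c + d) r i l) ∈ I n := by
  have h2 : i ≠ l := by
    rintro rfl
    have : (k : ℕ) < i := hki
    omega
  have : X d i k * S c r k l - (chiVal d i k • S c r k l + sg d 1 ^ (r + 1) • S (c + d) r i l) =
      sg d c • (S c r k l * Z d i k) := by
    rw [Z, X_mul_S, mul_sub, smul_sub, ← Algebra.commutes, ← Algebra.smul_def, smul_smul,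
      sg_mul_chiVal, if_neg h2, if_pos rfl]
    simp only [smul_zero]
    abel
  rw [this]
  exact smul_mem_I _ ((I n).mul_mem_left _ (Z_mem_I d i k hki))

/-- Modulo a subspace that contains `I_χ`, the recursion for the elements `S c r i l` of the first
column `l` reduces to the terms with `k ≥ i` and the element above. -/
theorem S_succ_sub_mem (V : Submodule ℂ (Env n)) (hV : ∀ u ∈ I n, u ∈ V) (r : ℕ) (i l : Fin n)
    (hl : (l : ℕ) = 0) (hS : ∀ c, S c r i l ∈ V) (c : ZMod 2) (u : Env n)
    (hu : ∑ k with i ≤ k, (X 0 i k * S c r k l + (-1 : ℂ) ^ r • (X 1 i k * S (c + 1) r k l)) - u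
      ∈ V) :
    S c (r + 1) i l - ∑ k : Fin n, (if (i : ℕ) = k + 1 then S c r k l else 0) - u ∈ V := by
  have h1 : S c (r + 1) i l =
      ∑ k, (X 0 i k * S c r k l + (-1 : ℂ) ^ r • (X 1 i k * S (c + 1) r k l)) := by
    rw [S_succ, Finset.sum_add_distrib, Finset.smul_sum]
  rw [h1, ← Finset.sum_filter_add_sum_filter_not _ (fun k => i ≤ k), add_sub_right_comm,
    add_sub_right_comm, sub_right_comm, sub_add_eq_add_sub, add_sub_assoc]
  refine V.add_mem hu ?_
  rw [← Finset.sum_filter_add_sum_filter_not (f := fun k : Fin n =>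
    if (i : ℕ) = k + 1 then S c r k l else 0) _ (fun k => i ≤ k)]
  have h2 : ∑ k : Fin n with i ≤ k, (if (i : ℕ) = k + 1 then S c r k l else 0) = 0 := by
    refine Finset.sum_eq_zero fun k hk => if_neg ?_
    have : (i : ℕ) ≤ k := (Finset.mem_filter.1 hk).2
    omega
  rw [h2, zero_add, ← Finset.sum_sub_distrib]
  refine V.sum_mem fun k hk => ?_
  have hki : k < i := not_le.1 (Finset.mem_filter.1 hk).2
  have e0 := V.add_mem (hV _ (X_mul_S_sub_mem_I 0 c r i k l hl hki)) (hS c)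
  have e1 := V.add_mem (hV _ (X_mul_S_sub_mem_I 1 (c + 1) r i k l hl hki))
    (V.smul_mem (sg 1 1 ^ (r + 1)) (hS (c + 1 + 1)))
  have hc0 : chiVal 0 i k • S c r k l = if (i : ℕ) = k + 1 then S c r k l else 0 := by
    simp [chiVal]
  have hc1 : chiVal 1 i k • S (c + 1) r k l = 0 := by simp [chiVal]
  rw [hc0, add_zero, sg_zero_left, one_pow, one_smul] at e0
  rw [hc1] at e1
  have := V.add_mem e0 (V.smul_mem ((-1 : ℂ) ^ r) e1)
  convert this using 1
  rw [zero_add, sub_add_cancel]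
  abel

/-- Modulo `I_χ`, raising `r` moves the single entry `1` of the first column down one row, because
`χ` is nonzero exactly on the elements `e` just below the diagonal. Rows count from `0`, so in the
last row the `1` appears in degree `n - 1`. -/
theorem S_sub_mem_I (r : ℕ) (l : Fin n) (hl : (l : ℕ) = 0) (c : ZMod 2) (i : Fin n) (hi : r ≤ i) :
    S c r i l - (if c = 0 ∧ r = i then 1 else 0) ∈ I n := by
  induction r generalizing c i with
  | zero =>
    have h : i = l ↔ 0 = (i : ℕ) := by rw [Fin.ext_iff, hl]; exact eq_comm
    rcases ZMod.two_cases c with rfl | rfl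
    · simp [S_zero_zero, h]
    · simp [S_one_zero]
  | succ r ih =>
    have h1 : ∀ c k, i ≤ k → S c r k l ∈ I n := by
      intro c k hk
      have hk' : (i : ℕ) ≤ k := hk
      have := ih c k (by omega)
      rwa [if_neg (by omega), sub_zero] at this
    have h2 := S_succ_sub_mem ((I n).restrictScalars ℂ) (fun u hu => hu) r i l hl
      (fun c => h1 c i le_rfl) c 0 (by
        rw [sub_zero]
        refine Submodule.sum_mem _ fun k hk => ?_
        have hk := (Finset.mem_filter.1 hk).2
        exact Submodule.add_mem _ ((I n).mul_mem_left _ (h1 _ k hk))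
          (Submodule.smul_mem _ _ ((I n).mul_mem_left _ (h1 _ k hk))))
    rw [sub_zero] at h2
    have hi' : (i : ℕ) - 1 < n := by omega
    have h3 : ∑ k : Fin n, (if (i : ℕ) = k + 1 then S c r k l else 0) =
        S c r ⟨(i : ℕ) - 1, hi'⟩ l := by
      rw [Finset.sum_eq_single ⟨(i : ℕ) - 1, hi'⟩]
      · rw [if_pos]
        simp only
        omega
      · intro k _ hk
        refine if_neg fun h => hk (Fin.ext ?_)
        simp only
        omega
      · simp
    rw [h3] at h2
    have h4 := ih c ⟨(i : ℕ) - 1, hi'⟩ (by simp only; omega)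
    have := (I n).add_mem h2 h4
    convert this using 1
    have : (r + 1 = (i : ℕ)) ↔ r = (i : ℕ) - 1 := by omega
    simp only [this]
    abel


/-! ### The Kazhdan-type filtration -/

section Filtration

/-- `X c i j` for natural numbers `i`, `j`, extended by zero. -/
def XN (n : ℕ) (c : ZMod 2) (i j : ℕ) : Env n :=
  if h : i < n ∧ j < n then X c ⟨i, h.1⟩ ⟨j, h.2⟩ else 0

theorem XN_of_lt (c : ZMod 2) {i j : ℕ} (hi : i < n) (hj : j < n) :
    XN n c i j = X c ⟨i, hi⟩ ⟨j, hj⟩ := dif_pos ⟨hi, hj⟩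

theorem XN_mul_XN (c d : ZMod 2) {i j k l : ℕ} (hi : i < n) (hj : j < n) (hk : k < n)
    (hl : l < n) : XN n c i j * XN n d k l = sg c d • (XN n d k l * XN n c i j)
      + (if j = k then XN n (c + d) i l else 0)
      - sg c d • (if i = l then XN n (c + d) k j else 0) := by
  rw [XN_of_lt c hi hj, XN_of_lt d hk hl, XN_of_lt _ hi hl, XN_of_lt _ hk hj, X_mul_X]
  simp only [Fin.mk.injEq]

/-- `Z c i j` for natural numbers `i`, `j`. -/
def ZN (n : ℕ) (c : ZMod 2) (i j : ℕ) : Env n := XN n c i j - algebraMap ℂ (Env n) (chiVal c i j)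

theorem ZN_mul_mem_I {y : Env n} (hy : y ∈ whittaker n) (c : ZMod 2) {i j : ℕ} (hij : j < i)
    (hi : i < n) : ZN n c i j * y ∈ I n := by
  have := Z_mul_mem_I hy c ⟨i, hi⟩ ⟨j, hij.trans hi⟩ hij
  rwa [Z, ← XN_of_lt] at this

theorem ZN_mul_XN (c d : ZMod 2) {i j k l : ℕ} (hi : i < n) (hj : j < n) (hk : k < n)
    (hl : l < n) : ZN n c i j * XN n d k l = sg c d • (XN n d k l * ZN n c i j)
      + (if j = k then XN n (c + d) i l else 0)
      - sg c d • (if i = l then XN n (c + d) k j else 0) := by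
  rw [ZN, sub_mul, XN_mul_XN c d hi hj hk hl, mul_sub, smul_sub, ← Algebra.commutes,
    ← Algebra.smul_def, smul_smul, sg_mul_chiVal]
  abel

/-- Labels of standard basis elements. -/
abbrev Label : Type := ZMod 2 × ℕ × ℕ

/-- The labels of the upper triangular elements outside the last column. -/
def Label.Valid (n : ℕ) (s : Label) : Prop := s.2.1 ≤ s.2.2 ∧ s.2.2 + 1 < n

/-- Half the Kazhdan degree. -/
def Label.wt (s : Label) : ℤ := (s.2.2 : ℤ) - s.2.1 + 1

/-- The basis element with a given label. -/
def Label.elt (n : ℕ) (s : Label) : Env n := XN n s.1 s.2.1 s.2.2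

/-- A product of basis elements. -/
def mon (n : ℕ) (l : List Label) : Env n := (l.map (Label.elt n)).prod

/-- The weight of a product of basis elements. -/
def lwt (l : List Label) : ℤ := (l.map Label.wt).sum

theorem length_le_lwt (l : List Label) (hl : ∀ s ∈ l, s.Valid n) : (l.length : ℤ) ≤ lwt l := by
  induction l with
  | nil => simp [lwt]
  | cons s l ih =>
    have h1 := ih fun s hs => hl s (List.mem_cons_of_mem _ hs)
    have h2 := (hl s List.mem_cons_self).1
    simp only [lwt, List.map_cons, List.sum_cons, List.length_cons, Label.wt] at h1 ⊢
    push_cast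
    omega

/-- The filtration of `U(Q(n))` by weight and, within a weight, by length, relative to a
subalgebra `W'`. -/
def filt (W' : Subalgebra ℂ (Env n)) (k : ℤ) (p : ℕ) : Submodule ℂ (Env n) :=
  Submodule.span ℂ {u | ∃ l w, (∀ s ∈ l, Label.Valid n s) ∧ w ∈ W' ∧
    (lwt l < k ∨ (lwt l = k ∧ p ≤ l.length)) ∧ u = mon n l * w} ⊔ (I n).restrictScalars ℂ

variable {W' : Subalgebra ℂ (Env n)}

theorem mem_filt_of_mem_I {u : Env n} (hu : u ∈ I n) (k : ℤ) (p : ℕ) : u ∈ filt W' k p :=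
  Submodule.mem_sup_right hu

theorem mon_mul_mem_filt {l : List Label} {w : Env n} (hl : ∀ s ∈ l, Label.Valid n s)
    (hw : w ∈ W') {k : ℤ} {p : ℕ} (h : lwt l < k ∨ (lwt l = k ∧ p ≤ l.length)) :
    mon n l * w ∈ filt W' k p :=
  Submodule.mem_sup_left (Submodule.subset_span ⟨l, w, hl, hw, h, rfl⟩)

theorem filt_induction (T : Submodule ℂ (Env n)) (L : Env n →ₗ[ℂ] Env n) (k : ℤ) (p : ℕ)
    (h : ∀ l w, (∀ s ∈ l, Label.Valid n s) → w ∈ W' → (lwt l < k ∨ (lwt l = k ∧ p ≤ l.length)) →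
      L (mon n l * w) ∈ T)
    (hI : ∀ u ∈ I n, L u ∈ T) {u : Env n} (hu : u ∈ filt W' k p) : L u ∈ T := by
  have : filt W' k p ≤ T.comap L := by
    refine sup_le (Submodule.span_le.2 ?_) hI
    rintro _ ⟨l, w, hl, hw, hk, rfl⟩
    exact h l w hl hw hk
  exact this hu

theorem filt_mono {k k' : ℤ} {p p' : ℕ} (h : k < k' ∨ (k = k' ∧ p' ≤ p)) :
    filt W' k p ≤ filt W' k' p' := by
  intro u hu
  refine filt_induction (filt W' k' p') LinearMap.id k p (fun l w hl hw hk => ?_)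
    (fun u hu => mem_filt_of_mem_I hu _ _) hu
  exact mon_mul_mem_filt hl hw (by omega)

theorem elt_mul_mem_filt {s : Label} (hs : s.Valid n) {k : ℤ} {p : ℕ} {u : Env n}
    (hu : u ∈ filt W' k p) : s.elt n * u ∈ filt W' (k + s.wt) (p + 1) := by
  refine filt_induction _ (LinearMap.mulLeft ℂ (s.elt n)) k p (fun l w hl hw hk => ?_)
    (fun u hu => mem_filt_of_mem_I ((I n).mul_mem_left _ hu) _ _) hu
  have : s.elt n * (mon n l * w) = mon n (s :: l) * w := by simp [mon, mul_assoc]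
  rw [LinearMap.mulLeft_apply, this]
  refine mon_mul_mem_filt ?_ hw ?_
  · rintro t ht
    rcases List.mem_cons.1 ht with rfl | ht
    exacts [hs, hl t ht]
  · simp only [lwt, List.map_cons, List.sum_cons, List.length_cons] at hk ⊢
    omega

theorem XN_mul_mem_filt_of_ZN {k : ℤ} {u : Env n} {p : ℕ} (hu : u ∈ filt W' k p)
    (h : ∀ (c : ZMod 2) (i j : ℕ), j < i → i < n → ZN n c i j * u ∈ filt W' (k - (i - j)) 0)
    (c : ZMod 2) {i j : ℕ} (hi : i < n) (hj : j + 1 < n) :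
    XN n c i j * u - chiVal c i j • u ∈ filt W' (k + (j - i + 1)) (p + 1) := by
  by_cases hij : i ≤ j
  · have := elt_mul_mem_filt (s := (c, i, j)) ⟨hij, hj⟩ hu
    rw [chiVal, if_neg (by omega), zero_smul, sub_zero]
    exact this
  · have h1 := h c i j (by omega) hi
    rw [ZN, sub_mul, ← Algebra.smul_def] at h1
    exact filt_mono (by omega) h1

theorem chiVal_smul_mem_filt {k : ℤ} {u : Env n} {p : ℕ} (hu : u ∈ filt W' k p) (c : ZMod 2)
    (i j : ℕ) : chiVal c i j • u ∈ filt W' (k + (j - i + 1)) p := by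
  by_cases h : c = 0 ∧ i = j + 1
  · exact Submodule.smul_mem _ _ (filt_mono (by omega) hu)
  · rw [chiVal, if_neg h, zero_smul]
    exact Submodule.zero_mem _

theorem XN_mul_mem_filt_of_ZN' {k : ℤ} {u : Env n} (hu : u ∈ filt W' k 0)
    (h : ∀ (c : ZMod 2) (i j : ℕ), j < i → i < n → ZN n c i j * u ∈ filt W' (k - (i - j)) 0)
    (c : ZMod 2) {i j : ℕ} (hi : i < n) (hj : j + 1 < n) :
    XN n c i j * u ∈ filt W' (k + (j - i + 1)) 0 := by
  have h1 := XN_mul_mem_filt_of_ZN hu h c hi hj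
  have h2 := chiVal_smul_mem_filt hu c i j
  have := Submodule.add_mem _ (filt_mono (W' := W') (by omega) h1 : _ ∈ filt W' _ 0) h2
  rwa [sub_add_cancel] at this

variable (hW : W' ≤ whittaker n)

include hW in
-- Since `Z` sends `w` into `I_χ`, only commutators with the letters survive, and a commutator has
-- weight one less than the sum of the weights `j - i + 1` of its factors.
theorem ZN_mul_mon_mem (l : List Label) (hl : ∀ s ∈ l, Label.Valid n s) (w : Env n) (hw : w ∈ W')
    (c : ZMod 2) (i j : ℕ) (hij : j < i) (hi : i < n) :
    ZN n c i j * (mon n l * w) ∈ filt W' (lwt l - (i - j)) 0 := by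
  induction l generalizing c i j with
  | nil =>
    refine mem_filt_of_mem_I ?_ _ _
    simpa [mon] using ZN_mul_mem_I (hW hw) c hij hi
  | cons s l ih =>
    have hl' : ∀ s ∈ l, Label.Valid n s := fun s hs => hl s (List.mem_cons_of_mem _ hs)
    have hs := hl s List.mem_cons_self
    obtain ⟨d, p, q⟩ := s
    obtain ⟨hpq, hq⟩ : p ≤ q ∧ q + 1 < n := hs
    have ih' := ih hl'
    have hy : mon n l * w ∈ filt W' (lwt l) 0 := mon_mul_mem_filt hl' hw (by omega)
    have hwt : lwt ((d, p, q) :: l) = lwt l + (q - p + 1) := by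
      simp [lwt, Label.wt]; ring
    have hm : ZN n c i j * (mon n ((d, p, q) :: l) * w) =
        sg c d • (XN n d p q * (ZN n c i j * (mon n l * w)))
        + (if j = p then XN n (c + d) i q * (mon n l * w) else 0)
        - sg c d • (if i = q then XN n (c + d) p j * (mon n l * w) else 0) := by
      simp only [mon, List.map_cons, List.prod_cons, Label.elt]
      rw [mul_assoc, ← mul_assoc, ZN_mul_XN c d hi (hij.trans hi) (by omega) (by omega)]
      simp only [sub_mul, add_mul, smul_mul_assoc, ite_mul, zero_mul, mul_assoc]
    rw [hm, hwt]
    refine Submodule.sub_mem _ (Submodule.add_mem _ (Submodule.smul_mem _ _ ?_) ?_)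
      (Submodule.smul_mem _ _ ?_)
    · have := elt_mul_mem_filt (s := (d, p, q)) ⟨hpq, hq⟩ (ih' c i j hij hi)
      refine filt_mono ?_ this
      simp only [Label.wt]
      omega
    · split_ifs with h
      · exact filt_mono (by omega) (XN_mul_mem_filt_of_ZN' hy ih' (c + d) hi hq)
      · exact Submodule.zero_mem _
    · split_ifs with h
      · exact filt_mono (by omega)
          (XN_mul_mem_filt_of_ZN' hy ih' (c + d) (i := p) (j := j) (by omega) (by omega))
      · exact Submodule.zero_mem _

include hW in
theorem ZN_mul_mem_filt {k : ℤ} {p : ℕ} {u : Env n} (hu : u ∈ filt W' k p) (c : ZMod 2) (i j : ℕ)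
    (hij : j < i) (hi : i < n) : ZN n c i j * u ∈ filt W' (k - (i - j)) 0 := by
  refine filt_induction _ (LinearMap.mulLeft ℂ (ZN n c i j)) k p (fun l w hl hw hk => ?_)
    (fun u hu => mem_filt_of_mem_I ((I n).mul_mem_left _ hu) _ _) hu
  exact filt_mono (by omega) (ZN_mul_mon_mem hW l hl w hw c i j hij hi)

include hW in
-- To leading order a basis element either lengthens the word (`i ≤ j`, where `χ` is zero) or acts
-- as the scalar `χ` (`j < i`, where the difference is `Z` and has lower weight).
theorem XN_mul_sub_mem_filt {k : ℤ} {u : Env n} {p : ℕ} (hu : u ∈ filt W' k p) (c : ZMod 2)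
    {i j : ℕ} (hi : i < n) (hj : j + 1 < n) :
    XN n c i j * u - chiVal c i j • u ∈ filt W' (k + (j - i + 1)) (p + 1) :=
  XN_mul_mem_filt_of_ZN hu (ZN_mul_mem_filt hW hu) c hi hj

include hW in
theorem XN_mul_mem_filt {k : ℤ} {u : Env n} (hu : u ∈ filt W' k 0) (c : ZMod 2)
    {i j : ℕ} (hi : i < n) (hj : j + 1 < n) :
    XN n c i j * u ∈ filt W' (k + (j - i + 1)) 0 :=
  XN_mul_mem_filt_of_ZN' hu (ZN_mul_mem_filt hW hu) c hi hj

/-! ### The Euler operator -/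

/-- The alternating sums along diagonals dual to the elements `ZN n c (j + 1) i`. -/
def diagSum (n : ℕ) (c : ZMod 2) : ℕ → ℕ → Env n
  | 0, j => XN n c 0 j
  | i + 1, 0 => XN n c (i + 1) 0
  | i + 1, j + 1 => XN n c (i + 1) (j + 1) + sg c 1 • diagSum n c i j

theorem diagSum_mem_span (c : ZMod 2) (i j : ℕ) (hij : i ≤ j) : diagSum n c i j ∈
    Submodule.span ℂ {u | ∃ a b : ℕ, a ≤ i ∧ (b : ℤ) - a = j - i ∧ u = XN n c a b} := by
  induction i generalizing j with
  | zero => exact Submodule.subset_span ⟨0, j, le_rfl, rfl, by rw [diagSum]⟩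
  | succ i ih =>
    obtain ⟨j, rfl⟩ : ∃ j', j = j' + 1 := ⟨j - 1, by omega⟩
    rw [diagSum]
    refine Submodule.add_mem _ (Submodule.subset_span ⟨i + 1, j + 1, le_rfl, rfl, rfl⟩)
      (Submodule.smul_mem _ _ ?_)
    refine Submodule.span_mono ?_ (ih j (by omega))
    rintro _ ⟨a, b, ha, hb, rfl⟩
    exact ⟨a, b, by omega, by push_cast; omega, rfl⟩

theorem diagSum_induction (c : ZMod 2) {i j : ℕ} (hij : i ≤ j) (T : Submodule ℂ (Env n))
    (L : Env n →ₗ[ℂ] Env n)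
    (h : ∀ a b : ℕ, a ≤ b → b ≤ j → (b : ℤ) - a = j - i → L (XN n c a b) ∈ T) :
    L (diagSum n c i j) ∈ T := by
  have : Submodule.span ℂ {u | ∃ a b : ℕ, a ≤ i ∧ (b : ℤ) - a = j - i ∧ u = XN n c a b}
      ≤ T.comap L := by
    refine Submodule.span_le.2 ?_
    rintro _ ⟨a, b, ha, hb, rfl⟩
    exact h a b (by omega) (by omega) hb
  exact this (diagSum_mem_span c i j hij)

theorem diagSum_mul_mem_filt (c : ZMod 2) {i j : ℕ} (hij : i ≤ j) (hj : j + 1 < n) {k : ℤ} {p : ℕ}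
    {u : Env n} (hu : u ∈ filt W' k p) :
    diagSum n c i j * u ∈ filt W' (k + (j - i + 1)) (p + 1) := by
  refine diagSum_induction c hij _ (LinearMap.mulRight ℂ u) fun a b hab hb h => ?_
  have := elt_mul_mem_filt (s := (c, a, b)) ⟨hab, by simp only; omega⟩ hu
  refine filt_mono ?_ this
  simp only [Label.wt]
  omega

include hW in
theorem diagSum_comm_mem_filt (c : ZMod 2) {i j : ℕ} (hij : i ≤ j) (hj : j + 1 < n) {k : ℤ}
    {u : Env n} (hu : u ∈ filt W' k 0) (d : ZMod 2) {p q : ℕ} (hpq : p ≤ q) (hq : q + 1 < n) :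
    sg c d • (diagSum n c i j * (XN n d p q * u)) - XN n d p q * (diagSum n c i j * u) ∈
      filt W' (k + (j - i) + (q - p + 1)) 0 := by
  refine diagSum_induction c hij _ (sg c d • LinearMap.mulRight ℂ (XN n d p q * u)
    - (LinearMap.mulLeft ℂ (XN n d p q)).comp (LinearMap.mulRight ℂ u)) fun a b hab hb h => ?_
  have h1 : (sg c d • LinearMap.mulRight ℂ (XN n d p q * u)
      - (LinearMap.mulLeft ℂ (XN n d p q)).comp (LinearMap.mulRight ℂ u)) (XN n c a b) =
      sg c d • (if b = p then XN n (c + d) a q * u else 0)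
      - (if a = q then XN n (c + d) p b * u else 0) := by
    simp only [LinearMap.sub_apply, LinearMap.smul_apply, LinearMap.comp_apply,
      LinearMap.mulRight_apply, LinearMap.mulLeft_apply]
    rw [← mul_assoc, XN_mul_XN c d (by omega) (by omega) (by omega) (by omega)]
    simp only [sub_mul, add_mul, smul_mul_assoc, ite_mul, zero_mul, mul_assoc, smul_sub, smul_add,
      smul_smul, sg_mul_self, one_smul]
    abel
  rw [h1]
  refine Submodule.sub_mem _ (Submodule.smul_mem _ _ ?_) ?_
  · split_ifs with h2
    · exact filt_mono (by omega) (XN_mul_mem_filt hW hu (c + d) (i := a) (by omega) hq)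
    · exact Submodule.zero_mem _
  · split_ifs with h2
    · exact filt_mono (by omega) (XN_mul_mem_filt hW hu (c + d) (i := p) (j := b) (by omega)
        (by omega))
    · exact Submodule.zero_mem _

/-- The index set of the sum that defines the Euler operator. -/
def eulerIndex (n : ℕ) : Finset Label :=
  Finset.univ ×ˢ ((Finset.range n ×ˢ Finset.range n).filter fun t => t.1 ≤ t.2 ∧ t.2 + 1 < n)

theorem mem_eulerIndex (t : Label) : t ∈ eulerIndex n ↔ t.Valid n := by
  simp only [eulerIndex, Finset.mem_product, Finset.mem_univ, true_and, Finset.mem_filter,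
    Finset.mem_range, Label.Valid]
  omega

/-- The Euler operator `∑ x a`: modulo lower terms it multiplies a product of `p` basis elements
by `p`. -/
def euler (n : ℕ) : Env n :=
  ∑ t ∈ eulerIndex n, diagSum n t.1 t.2.1 t.2.2 * ZN n t.1 (t.2.2 + 1) t.2.1

/-- The coefficients are the values of `χ` on the brackets of `Z` with `X d p q`: to leading order,
`Z c (j + 1) i` is $\partial_{i,j}\mp\partial_{i+1,j+1}$. Only two labels contribute, and the
difference of consecutive diagonal sums is the letter itself. -/
theorem sum_diagSum {d : ZMod 2} {p q : ℕ} (hpq : p ≤ q) (hq : q + 1 < n) :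
    ∑ t ∈ eulerIndex n, ((if t.2.1 = p then chiVal (t.1 + d) (t.2.2 + 1) q else 0)
      - sg t.1 d * (if t.2.2 + 1 = q then chiVal (t.1 + d) p t.2.1 else 0)) •
        diagSum n t.1 t.2.1 t.2.2 = XN n d p q := by
  have hd : ∀ c : ZMod 2, c + d = 0 ↔ c = d := by revert d; decide
  have h1 : ∀ t : Label, (if t.2.1 = p then chiVal (t.1 + d) (t.2.2 + 1) q else 0) •
      diagSum n t.1 t.2.1 t.2.2 = if t = (d, p, q) then diagSum n d p q else 0 := by
    rintro ⟨c, i, j⟩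
    by_cases h : (c, i, j) = ((d, p, q) : Label)
    · obtain ⟨rfl, rfl, rfl⟩ : c = d ∧ i = p ∧ j = q := by simpa using h
      simp [chiVal, hd]
    · rw [if_neg h]
      simp only [Prod.mk.injEq] at h
      simp only [chiVal, hd]
      split_ifs with h2 h3
      · exact absurd ⟨h3.1, h2, by omega⟩ h
      · simp
      · simp
  have h2 : ∀ t ∈ eulerIndex n, (sg t.1 d * (if t.2.2 + 1 = q then chiVal (t.1 + d) p t.2.1 else 0))
      • diagSum n t.1 t.2.1 t.2.2 = if t = (d, p - 1, q - 1) then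
        (if 0 < p then sg d 1 • diagSum n d (p - 1) (q - 1) else 0) else 0 := by
    rintro ⟨c, i, j⟩ -
    by_cases h : (c, i, j) = ((d, p - 1, q - 1) : Label)
    · obtain ⟨rfl, rfl, rfl⟩ : c = d ∧ i = p - 1 ∧ j = q - 1 := by simpa using h
      have hs : sg c c = sg c 1 := by rcases ZMod.two_cases c with rfl | rfl <;> simp
      by_cases hp : 0 < p
      · simp only [chiVal, hd, true_and, hs]
        rw [if_pos (show q - 1 + 1 = q by omega), if_pos (show p = p - 1 + 1 by omega), if_pos hp]
        simp
      · simp only [chiVal, hd, true_and]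
        rw [if_neg (show ¬ p = p - 1 + 1 by omega), if_neg hp]
        simp
    · rw [if_neg h]
      simp only [Prod.mk.injEq] at h
      simp only [chiVal, hd]
      split_ifs with h2 h3
      · exact absurd ⟨h3.1, by omega, by omega⟩ h
      · simp
      · simp
  simp only [sub_smul, Finset.sum_sub_distrib]
  rw [Finset.sum_congr rfl fun t _ => h1 t, Finset.sum_congr rfl h2, Finset.sum_ite_eq',
    Finset.sum_ite_eq', if_pos ((mem_eulerIndex _).2 ⟨hpq, hq⟩),
    if_pos ((mem_eulerIndex _).2 ⟨by simp only; omega, by simp only; omega⟩)]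
  match p, q, hpq with
  | 0, q, _ => simp [diagSum]
  | p + 1, q + 1, _ => simp [diagSum]

include hW in
-- A Leibniz rule, by induction on the word: each letter contributes itself once by `sum_diagSum`,
-- and every other term has lower weight or more letters.
theorem euler_mul_mon (l : List Label) (hl : ∀ s ∈ l, Label.Valid n s) (w : Env n) (hw : w ∈ W') :
    euler n * (mon n l * w) - (l.length : ℂ) • (mon n l * w) ∈ filt W' (lwt l) (l.length + 1) := by
  induction l with
  | nil =>
    refine mem_filt_of_mem_I ?_ _ _
    simp only [euler, mon, List.map_nil, List.prod_nil, one_mul, List.length_nil, Nat.cast_zero,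
      zero_smul, sub_zero, Finset.sum_mul, mul_assoc]
    refine Submodule.sum_mem _ fun t ht => (I n).mul_mem_left _ ?_
    have := (mem_eulerIndex _).1 ht
    exact ZN_mul_mem_I (hW hw) _ (Nat.lt_succ_of_le this.1) this.2
  | cons s l ih =>
    have hl' : ∀ s ∈ l, Label.Valid n s := fun s hs => hl s (List.mem_cons_of_mem _ hs)
    have hs := hl s List.mem_cons_self
    obtain ⟨d, p, q⟩ := s
    obtain ⟨hpq, hq⟩ : p ≤ q ∧ q + 1 < n := hs
    have ih' := ih hl'
    have hy : mon n l * w ∈ filt W' (lwt l) l.length := mon_mul_mem_filt hl' hw (by omega)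
    have hwt : lwt ((d, p, q) :: l) = lwt l + (q - p + 1) := by
      simp [lwt, Label.wt]; ring
    have hm : mon n ((d, p, q) :: l) * w = XN n d p q * (mon n l * w) := by
      simp [mon, Label.elt, mul_assoc]
    rw [hm, hwt, List.length_cons]
    generalize mon n l * w = y at hy ih' ⊢
    have hterm : ∀ t ∈ eulerIndex n,
        diagSum n t.1 t.2.1 t.2.2 * ZN n t.1 (t.2.2 + 1) t.2.1 * (XN n d p q * y)
        - XN n d p q * (diagSum n t.1 t.2.1 t.2.2 * ZN n t.1 (t.2.2 + 1) t.2.1 * y)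
        - (((if t.2.1 = p then chiVal (t.1 + d) (t.2.2 + 1) q else 0)
          - sg t.1 d * (if t.2.2 + 1 = q then chiVal (t.1 + d) p t.2.1 else 0)) •
          diagSum n t.1 t.2.1 t.2.2) * y ∈
        filt W' (lwt l + (q - p + 1)) (l.length + 1 + 1) := by
      rintro ⟨c, i, j⟩ ht
      obtain ⟨hij, hj⟩ : i ≤ j ∧ j + 1 < n := (mem_eulerIndex _).1 ht
      simp only
      have hZ := ZN_mul_mem_filt hW hy c (j + 1) i (by omega) hj
      -- `e1`: reordering costs weight. `e2`, `e3`: replacing a bracket by its value under `χ`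
      -- leaves one extra letter, and the diagonal sum adds another.
      have e1 := diagSum_comm_mem_filt hW c hij hj hZ d hpq hq
      have e2 : (if i = p then diagSum n c i j * (XN n (c + d) (j + 1) q * y
          - chiVal (c + d) (j + 1) q • y) else 0) ∈
          filt W' (lwt l + (q - p + 1)) (l.length + 1 + 1) := by
        split_ifs with h
        · exact filt_mono (by push_cast; omega) (diagSum_mul_mem_filt c hij hj
            (XN_mul_sub_mem_filt hW hy (c + d) hj hq))
        · exact Submodule.zero_mem _
      have e3 : (if j + 1 = q then diagSum n c i j * (XN n (c + d) p i * y
          - chiVal (c + d) p i • y) else 0) ∈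
          filt W' (lwt l + (q - p + 1)) (l.length + 1 + 1) := by
        split_ifs with h
        · exact filt_mono (by push_cast; omega) (diagSum_mul_mem_filt c hij hj
            (XN_mul_sub_mem_filt hW hy (c + d) (i := p) (j := i) (by omega) (by omega)))
        · exact Submodule.zero_mem _
      have := Submodule.sub_mem _ (Submodule.add_mem _ (filt_mono (by push_cast; omega) e1) e2)
        (Submodule.smul_mem _ (sg c d) e3)
      convert this using 1
      rw [mul_assoc, ← mul_assoc (ZN n c (j + 1) i),
        ZN_mul_XN c d hj (by omega) (by omega) (by omega)]
      simp only [sub_mul, add_mul, smul_mul_assoc, ite_mul, zero_mul, mul_assoc, mul_add, mul_sub,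
        mul_smul_comm, mul_ite, mul_zero, sub_smul, ite_smul, zero_smul, smul_sub, smul_ite,
        smul_zero, smul_smul]
      split_ifs <;> (try simp) <;> abel
    have hsum := Submodule.sum_mem _ hterm
    rw [Finset.sum_sub_distrib, Finset.sum_sub_distrib, ← Finset.sum_mul, ← Finset.mul_sum,
      ← Finset.sum_mul, ← Finset.sum_mul, sum_diagSum hpq hq] at hsum
    have h2 := elt_mul_mem_filt (s := (d, p, q)) ⟨hpq, hq⟩ ih'
    have h3 := Submodule.add_mem _ hsum (filt_mono (Or.inr ⟨by simp only [Label.wt], le_rfl⟩) h2)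
    convert h3 using 1
    simp only [Label.elt, euler, mul_sub, mul_smul_comm, Nat.cast_add, Nat.cast_one, add_smul,
      one_smul]
    abel

include hW in
theorem euler_mul_sub_mem_filt {k : ℤ} {p : ℕ} {u : Env n} (hu : u ∈ filt W' k p) :
    euler n * u - (p : ℂ) • u ∈ filt W' k (p + 1) := by
  refine filt_induction _ (LinearMap.mulLeft ℂ (euler n) - (p : ℂ) • LinearMap.id) k p
    (fun l w hl hw hk => ?_) (fun u hu => mem_filt_of_mem_I (Submodule.sub_mem _
      ((I n).mul_mem_left _ hu) (smul_mem_I _ hu)) _ _) hu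
  have h1 := euler_mul_mon hW l hl w hw
  have h2 : ((l.length : ℂ) - p) • (mon n l * w) ∈ filt W' k (p + 1) := by
    by_cases h : lwt l = k ∧ l.length = p
    · rw [h.2, sub_self, zero_smul]
      exact Submodule.zero_mem _
    · exact Submodule.smul_mem _ _ (mon_mul_mem_filt hl hw (by omega))
  have h3 := Submodule.add_mem _ (filt_mono (by omega) h1) h2
  convert h3 using 1
  simp only [LinearMap.sub_apply, LinearMap.mulLeft_apply, LinearMap.smul_apply, LinearMap.id_apply,
    sub_smul]
  abel

theorem euler_mul_mem_I {y : Env n} (hy : y ∈ whittaker n) : euler n * y ∈ I n := by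
  rw [euler, Finset.sum_mul]
  refine Submodule.sum_mem _ fun t ht => ?_
  rw [mul_assoc]
  have := (mem_eulerIndex _).1 ht
  exact (I n).mul_mem_left _ (ZN_mul_mem_I hy _ (Nat.lt_succ_of_le this.1) this.2)

include hW in
-- The Euler operator sends `y` into `I_χ`, yet multiplies its part of length `p` by `p`; hence that
-- part can be absorbed into longer or lower words, for every `p`.
theorem mem_filt_zero_of_mem_whittaker {y : Env n} (hy : y ∈ whittaker n) (k : ℕ)
    (hk : y ∈ filt W' k 0) : y ∈ filt W' 0 0 := by
  induction k with
  | zero => exact_mod_cast hk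
  | succ k ih =>
    have hstep : ∀ p : ℕ, y ∈ filt W' (k + 1 : ℕ) (p + 1) := by
      intro p
      induction p with
      -- Positive weight excludes the empty word, so the lengths start at `1`, where division is
      -- possible.
      | zero =>
        refine filt_induction _ LinearMap.id _ 0 (fun l w hl hw hk => ?_)
          (fun u hu => mem_filt_of_mem_I hu _ _) hk
        refine mon_mul_mem_filt hl hw ?_
        rcases hk with hk | hk
        · exact Or.inl hk
        · refine Or.inr ⟨hk.1, ?_⟩
          rcases l with _ | ⟨s, l⟩
          · simp only [lwt, List.map_nil, List.sum_nil] at hk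
            omega
          · simp
      | succ p ih =>
        have h1 := euler_mul_sub_mem_filt hW ih
        have h2 := Submodule.sub_mem _ (mem_filt_of_mem_I (euler_mul_mem_I hy) _ _) h1
        rw [sub_sub_cancel] at h2
        exact (Submodule.smul_mem_iff _ (by exact_mod_cast p.succ_ne_zero)).1 h2
    -- Words of weight `k + 1` would now need length at least `k + 2`, but length never exceeds
    -- weight.
    refine ih (filt_induction _ LinearMap.id _ _ (fun l w hl hw hk => ?_)
      (fun u hu => mem_filt_of_mem_I hu _ _) (hstep (k + 1)))
    have := length_le_lwt l hl
    exact mon_mul_mem_filt hl hw (by push_cast at hk; omega)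

theorem exists_sub_mem_I_of_mem_filt_zero {y : Env n} (hy : y ∈ filt W' 0 0) :
    ∃ w ∈ W', y - w ∈ I n := by
  have h : y ∈ Subalgebra.toSubmodule W' ⊔ (I n).restrictScalars ℂ := by
    refine filt_induction _ LinearMap.id _ _ (fun l w hl hw hk => ?_)
      (fun u hu => Submodule.mem_sup_right hu) hy
    have := length_le_lwt l hl
    obtain rfl : l = [] := List.length_eq_zero_iff.1 (by omega)
    refine Submodule.mem_sup_left ?_
    simpa [mon] using hw
  obtain ⟨w, hw, u, hu, rfl⟩ := Submodule.mem_sup.1 h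
  exact ⟨w, hw, by simpa using hu⟩


end Filtration

/-! ### Spanning the enveloping algebra over the corner elements -/

section Generation

/-- The union of the filtration `filt W'`. -/
def filtUnion (W' : Subalgebra ℂ (Env n)) : Submodule ℂ (Env n) := ⨆ k : ℕ, filt W' k 0

variable {W' : Subalgebra ℂ (Env n)}

theorem mem_filtUnion {u : Env n} : u ∈ filtUnion W' ↔ ∃ k : ℕ, u ∈ filt W' k 0 := by
  have hmono : Monotone fun k : ℕ => filt W' k 0 := fun a b h =>
    filt_mono (by omega)
  exact Submodule.mem_iSup_of_directed _ hmono.directed_le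

theorem filt_le_filtUnion (k : ℤ) (p : ℕ) : filt W' k p ≤ filtUnion W' := fun _ hu =>
  mem_filtUnion.2 ⟨k.toNat, filt_mono (by omega) hu⟩

theorem mem_filtUnion_of_mem_I {u : Env n} (hu : u ∈ I n) : u ∈ filtUnion W' :=
  filt_le_filtUnion 0 0 (mem_filt_of_mem_I hu _ _)

theorem mon_mul_mem_filtUnion {l : List Label} {w : Env n} (hl : ∀ s ∈ l, Label.Valid n s)
    (hw : w ∈ W') : mon n l * w ∈ filtUnion W' :=
  filt_le_filtUnion (lwt l) 0 (mon_mul_mem_filt hl hw (by omega))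

theorem mem_filtUnion_of_mem {w : Env n} (hw : w ∈ W') : w ∈ filtUnion W' := by
  simpa [mon] using mon_mul_mem_filtUnion (l := []) (by simp) hw

theorem filtUnion_induction (T : Submodule ℂ (Env n)) (L : Env n →ₗ[ℂ] Env n)
    (h : ∀ l w, (∀ s ∈ l, Label.Valid n s) → w ∈ W' → L (mon n l * w) ∈ T)
    (hI : ∀ u ∈ I n, L u ∈ T) {u : Env n} (hu : u ∈ filtUnion W') : L u ∈ T := by
  obtain ⟨k, hk⟩ := mem_filtUnion.1 hu
  exact filt_induction T L k 0 (fun l w hl hw _ => h l w hl hw) hI hk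

variable (hW : W' ≤ whittaker n)

include hW in
theorem XN_mul_mem_filtUnion {u : Env n} (hu : u ∈ filtUnion W') (c : ZMod 2) {i j : ℕ}
    (hi : i < n) (hj : j + 1 < n) : XN n c i j * u ∈ filtUnion W' := by
  obtain ⟨k, hk⟩ := mem_filtUnion.1 hu
  exact filt_le_filtUnion _ _ (XN_mul_mem_filt hW hk c hi hj)

include hW in
theorem mul_mem_filtUnion {u w : Env n} (hu : u ∈ filtUnion W') (hw : w ∈ W') :
    u * w ∈ filtUnion W' := by
  refine filtUnion_induction _ (LinearMap.mulRight ℂ w) (fun l w' hl hw' => ?_)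
    (fun u hu => mem_filtUnion_of_mem_I (I_mul_mem_I hu (hW hw))) hu
  rw [LinearMap.mulRight_apply, mul_assoc]
  exact mon_mul_mem_filtUnion hl (W'.mul_mem hw' hw)

include hW in
-- Commutators of last-column elements with the letters stay in the last column, so such an element
-- can be moved right until it meets `w`.
theorem XN_last_mul_mem_filtUnion (h : ∀ (c : ZMod 2) (i : ℕ), i < n →
    XN n c i (n - 1) ∈ filtUnion W') {u : Env n} (hu : u ∈ filtUnion W') (c : ZMod 2) {i : ℕ}
    (hi : i < n) : XN n c i (n - 1) * u ∈ filtUnion W' := by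
  refine filtUnion_induction _ (LinearMap.mulLeft ℂ (XN n c i (n - 1))) (fun l w hl hw => ?_)
    (fun u hu => mem_filtUnion_of_mem_I ((I n).mul_mem_left _ hu)) hu
  rw [LinearMap.mulLeft_apply]
  clear hu
  induction l generalizing c i hi with
  | nil => simpa [mon] using mul_mem_filtUnion hW (h c i hi) hw
  | cons s l ih =>
    have hl' : ∀ s ∈ l, Label.Valid n s := fun s hs => hl s (List.mem_cons_of_mem _ hs)
    have hs := hl s List.mem_cons_self
    obtain ⟨d, p, q⟩ := s
    obtain ⟨hpq, hq⟩ : p ≤ q ∧ q + 1 < n := hs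
    have hm : XN n c i (n - 1) * (mon n ((d, p, q) :: l) * w) =
        sg c d • (XN n d p q * (XN n c i (n - 1) * (mon n l * w)))
        - sg c d • (if i = q then XN n (c + d) p (n - 1) * (mon n l * w) else 0) := by
      simp only [mon, List.map_cons, List.prod_cons, Label.elt]
      rw [mul_assoc, ← mul_assoc, XN_mul_XN c d hi (by omega) (by omega) (by omega),
        if_neg (by omega : ¬ n - 1 = p)]
      simp only [sub_mul, smul_mul_assoc, ite_mul, zero_mul, mul_assoc, add_zero]
    rw [hm]
    refine Submodule.sub_mem _ (Submodule.smul_mem _ _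
      (XN_mul_mem_filtUnion hW (ih c hi hl') d (by omega) hq)) (Submodule.smul_mem _ _ ?_)
    split_ifs
    · exact ih (c + d) (by omega) hl'
    · exact Submodule.zero_mem _

variable {k l : Fin n} (hk : (k : ℕ) + 1 = n) (hl : (l : ℕ) = 0)
  (hS : ∀ c r, S c r k l ∈ W')

include hW hk hl hS in
theorem X_mul_S_sub_mem_filtUnion (t : ℕ)
    (h1 : ∀ s ≤ t, ∀ (c : ZMod 2) (i : Fin n), S c (i + s) i l ∈ filtUnion W')
    (h2 : ∀ (c : ZMod 2) (i : Fin n), n ≤ i + t → X c i k ∈ filtUnion W')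
    (d c : ZMod 2) (i a : Fin n) (hia : i ≤ a) :
    X d i a * S c (i + t) a l - (if a = k then
      (if c = 0 ∧ (i : ℕ) + t + 1 = n then X d i k else 0) else 0) ∈ filtUnion W' := by
  have hia' : (i : ℕ) ≤ a := hia
  by_cases hak : a = k
  · subst hak
    rw [if_pos rfl]
    by_cases hit : n ≤ i + t
    · rw [if_neg (by omega), sub_zero]
      exact mul_mem_filtUnion hW (h2 d i hit) (hS _ _)
    · have h3 := S_sub_mem_I (i + t) l hl c a (by omega)
      have h4 : X d i a * (S c (i + t) a l - (if c = 0 ∧ (i : ℕ) + t = a then 1 else 0)) =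
          X d i a * S c (i + t) a l - (if c = 0 ∧ (i : ℕ) + t + 1 = n then X d i a else 0) := by
        have : (i : ℕ) + t + 1 = n ↔ (i : ℕ) + t = a := by omega
        simp only [mul_sub, this]
        split_ifs <;> simp
      rw [← h4]
      exact mem_filtUnion_of_mem_I ((I n).mul_mem_left _ h3)
  · have han : (a : ℕ) + 1 < n := by
      have : (a : ℕ) ≠ k := fun h => hak (Fin.ext h)
      omega
    rw [if_neg hak, sub_zero, ← XN_of_lt]
    refine XN_mul_mem_filtUnion hW ?_ d i.2 han
    by_cases hat : (a : ℕ) ≤ i + t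
    · have := h1 (i + t - a) (by omega) c a
      rwa [Nat.add_sub_cancel' hat] at this
    · have := S_sub_mem_I (i + t) l hl c a (by omega)
      rw [if_neg (by omega), sub_zero] at this
      exact mem_filtUnion_of_mem_I this

include hW hk hl hS in
-- Modulo what is already known, the recursion says that `S c (i + t + 1) i l` and its upper
-- neighbour on the same diagonal `degree = row + t + 1` agree, except at one row, where a
-- last-column element appears. The bottom entry lies in `W'` and there is nothing above the top
-- row, so the diagonal telescopes and isolates that element.
theorem S_mem_filtUnion_and_X_last_mem_filtUnion (t : ℕ) :
    (∀ s ≤ t, ∀ (c : ZMod 2) (i : Fin n), S c (i + s) i l ∈ filtUnion W') ∧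
      ∀ (c : ZMod 2) (i : Fin n), n ≤ i + t → X c i k ∈ filtUnion W' := by
  induction t with
  | zero =>
    refine ⟨fun s hs c i => ?_, fun c i hi => by omega⟩
    obtain rfl : s = 0 := by omega
    have h1 := mem_filtUnion_of_mem_I (W' := W') (S_sub_mem_I i l hl c i le_rfl)
    have h2 : (if c = 0 ∧ (i : ℕ) = i then 1 else 0 : Env n) ∈ filtUnion W' := by
      split_ifs
      · exact mem_filtUnion_of_mem W'.one_mem
      · exact Submodule.zero_mem _
    have := Submodule.add_mem _ h1 h2
    rwa [sub_add_cancel] at this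
  | succ t ih =>
    obtain ⟨h1, h2⟩ := ih
    have hterm := X_mul_S_sub_mem_filtUnion hW hk hl hS t h1 h2
    -- The new last-column element: it occurs in row `i = n - 1 - t`, where `S c (i + t)` in the
    -- last row has just become a constant modulo `I_χ`.
    let u : ZMod 2 → Env n := fun c => if c = 0 then XN n 0 (n - 1 - t) (n - 1)
      else (-1 : ℂ) ^ (n - 1) • XN n 1 (n - 1 - t) (n - 1)
    have hstep : ∀ (c : ZMod 2) (i : Fin n), S c (i + t + 1) i l
        - ∑ a : Fin n, (if (i : ℕ) = a + 1 then S c (i + t) a l else 0)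
        - (if (i : ℕ) + t + 1 = n then u c else 0) ∈ filtUnion W' := by
      intro c i
      refine S_succ_sub_mem _ (fun u hu => mem_filtUnion_of_mem_I hu) (i + t) i l hl
        (fun c => h1 t le_rfl c i) c _ ?_
      have hik : i ≤ k := by
        change (i : ℕ) ≤ k
        omega
      have hsum := Submodule.sum_mem (filtUnion W')
        (t := Finset.univ.filter fun a : Fin n => i ≤ a)
        (f := fun a => (X 0 i a * S c (i + t) a l - (if a = k then
          (if c = 0 ∧ (i : ℕ) + t + 1 = n then X 0 i k else 0) else 0)) + (-1 : ℂ) ^ ((i : ℕ) + t) •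
          (X 1 i a * S (c + 1) (i + t) a l - (if a = k then
          (if c + 1 = 0 ∧ (i : ℕ) + t + 1 = n then X 1 i k else 0) else 0)))
        (fun a ha => Submodule.add_mem _ (hterm 0 c i a (Finset.mem_filter.1 ha).2)
          (Submodule.smul_mem _ _ (hterm 1 (c + 1) i a (Finset.mem_filter.1 ha).2)))
      have hv : (if (i : ℕ) + t + 1 = n then u c else 0) =
          (if c = 0 ∧ (i : ℕ) + t + 1 = n then X 0 i k else 0) + (-1 : ℂ) ^ ((i : ℕ) + t) •
            (if c + 1 = 0 ∧ (i : ℕ) + t + 1 = n then X 1 i k else 0) := by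
        by_cases hit : (i : ℕ) + t + 1 = n
        · have e1 : n - 1 - t = i := by omega
          have e2 : n - 1 = k := by omega
          have e3 : (i : ℕ) + t = n - 1 := by omega
          simp only [u, e1, e3]
          rw [show XN n 0 i (n - 1) = X 0 i k by rw [e2, XN_of_lt 0 i.2 k.2],
            show XN n 1 i (n - 1) = X 1 i k by rw [e2, XN_of_lt 1 i.2 k.2]]
          have e4 : n - 1 + 1 = n := by omega
          rcases ZMod.two_cases c with rfl | rfl <;> simp [ZMod.one_add_one_two, e4]
        · simp [hit]
      convert hsum using 1
      rw [hv]
      simp only [smul_sub, Finset.sum_add_distrib, Finset.sum_sub_distrib,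
        ← Finset.smul_sum, Finset.sum_ite_eq', Finset.mem_filter, Finset.mem_univ, true_and, hik,
        if_true]
      abel
    have hdesc : ∀ (e : ℕ) (c : ZMod 2) (i : Fin n), (i : ℕ) + e + 1 = n →
        S c (i + t + 1) i l + (if (i : ℕ) + t + 1 < n then u c else 0) ∈ filtUnion W' := by
      intro e
      induction e with
      | zero =>
        intro c i hi
        obtain rfl : i = k := Fin.ext (by omega)
        rw [if_neg (by omega), add_zero]
        exact mem_filtUnion_of_mem (hS _ _)
      | succ e ihe =>
        intro c i hi
        have h3 := ihe c ⟨i + 1, by omega⟩ (by simp only; omega)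
        have h4 := hstep c ⟨i + 1, by omega⟩
        rw [Finset.sum_eq_single i (fun b _ hb => if_neg fun h => hb (Fin.ext
          (by simp only at h; omega))) (by simp), if_pos rfl] at h4
        have := Submodule.sub_mem _ h3 h4
        convert this using 1
        simp only [show (i : ℕ) + 1 + t = i + t + 1 by ring]
        rcases lt_trichotomy ((i : ℕ) + t + 1 + 1) n with h | h | h
        · rw [if_pos (by omega), if_pos (by omega), if_neg (by omega)]
          abel
        · rw [if_pos (by omega), if_neg (by omega), if_pos (by omega)]
          abel
        · rw [if_neg (by omega), if_neg (by omega), if_neg (by omega)]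
          abel
    -- In row `0` the sum over upper neighbours is empty, so comparing the descent with the
    -- recursion leaves only `u c`.
    have hlu : ∀ c, t + 1 ≤ n → u c ∈ filtUnion W' := by
      intro c ht
      have h3 := hdesc (n - 1) c l (by omega)
      have h4 := hstep c l
      rw [Finset.sum_eq_zero fun a _ => if_neg (by omega), sub_zero] at h4
      have := Submodule.sub_mem _ h3 h4
      convert this using 1
      rcases lt_or_eq_of_le ht with h | h
      · rw [if_pos (by omega), if_neg (by omega)]
        abel
      · rw [if_neg (by omega), if_pos (by omega)]
        abel
    refine ⟨fun s hs c i => ?_, fun c i hi => ?_⟩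
    · rcases hs.lt_or_eq with hs | rfl
      · exact h1 s (by omega) c i
      · have h3 := hdesc (n - 1 - i) c i (by omega)
        have h4 : (if (i : ℕ) + t + 1 < n then u c else 0) ∈ filtUnion W' := by
          split_ifs with h
          · exact hlu c (by omega)
          · exact Submodule.zero_mem _
        have := Submodule.sub_mem _ h3 h4
        rwa [add_sub_cancel_right] at this
    · by_cases hi' : n ≤ i + t
      · exact h2 c i hi'
      · have h3 := hlu c (by omega)
        have e1 : n - 1 - t = i := by omega
        have e2 : n - 1 = k := by omega
        simp only [u, e1] at h3
        rw [show XN n 0 i (n - 1) = X 0 i k by rw [e2, XN_of_lt 0 i.2 k.2],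
            show XN n 1 i (n - 1) = X 1 i k by rw [e2, XN_of_lt 1 i.2 k.2]] at h3
        rcases ZMod.two_cases c with rfl | rfl
        · simpa using h3
        · rw [if_neg one_ne_zero] at h3
          exact (Submodule.smul_mem_iff _ (pow_ne_zero _ (by norm_num))).1 h3

theorem adjoin_range_ι : Algebra.adjoin ℂ (Set.range (ι n)) = ⊤ := by
  have h1 : (Set.range (ι n)) = (RingQuot.mkAlgHom ℂ (EnvRel n)) ''
      Set.range (TensorAlgebra.ι ℂ) := by
    rw [← Set.range_comp]; rfl
  have h2 : Algebra.adjoin ℂ ((RingQuot.mkAlgHom ℂ (EnvRel n)) ''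
      Set.range (TensorAlgebra.ι ℂ (M := Queer n))) = ⊤ := by
    rw [← AlgHom.map_adjoin, TensorAlgebra.adjoin_range_ι, Algebra.map_top,
      AlgHom.range_eq_top]
    exact RingQuot.mkAlgHom_surjective _ _
  rw [h1]
  exact h2

include hW hk hl hS in
theorem filtUnion_eq_top : filtUnion W' = ⊤ := by
  have hX : ∀ (c : ZMod 2) (i j : Fin n) (u : Env n), u ∈ filtUnion W' →
      X c i j * u ∈ filtUnion W' := by
    intro c i j u hu
    rw [← XN_of_lt]
    by_cases hj : (j : ℕ) + 1 < n
    · exact XN_mul_mem_filtUnion hW hu c i.2 hj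
    · rw [show (j : ℕ) = n - 1 by omega]
      refine XN_last_mul_mem_filtUnion hW (fun c i hi => ?_) hu c i.2
      have := (S_mem_filtUnion_and_X_last_mem_filtUnion hW hk hl hS n).2 c ⟨i, hi⟩ (by omega)
      rwa [← XN_of_lt, show (k : ℕ) = n - 1 by omega] at this
  -- The left multipliers of `filtUnion W'` form a subalgebra containing the generators of
  -- `U(Q(n))`; apply it to `1`.
  let A : Subalgebra ℂ (Env n) :=
    { carrier := {a | ∀ u ∈ filtUnion W', a * u ∈ filtUnion W'}
      mul_mem' := fun {a b} ha hb u hu => by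
        rw [mul_assoc]
        exact ha _ (hb _ hu)
      add_mem' := fun {a b} ha hb u hu => by
        rw [add_mul]
        exact Submodule.add_mem _ (ha u hu) (hb u hu)
      algebraMap_mem' := fun t u hu => by
        rw [← Algebra.smul_def]
        exact Submodule.smul_mem _ _ hu }
  have hA : A = ⊤ := by
    rw [eq_top_iff, ← adjoin_range_ι]
    refine Algebra.adjoin_le ?_
    rintro _ ⟨x, rfl⟩ u hu
    rw [sum_basisElt x]
    simp only [map_sum, map_smul, Finset.sum_mul, smul_mul_assoc]
    exact Submodule.sum_mem _ fun c _ => Submodule.sum_mem _ fun i _ => Submodule.sum_mem _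
      fun j _ => Submodule.smul_mem _ _ (hX c i j u hu)
  refine eq_top_iff.2 fun a _ => ?_
  have ha : a ∈ A := hA ▸ Algebra.mem_top
  simpa using ha 1 (mem_filtUnion_of_mem W'.one_mem)

include hW hk hl hS in
/-- Modulo `I_χ`, the elements `S c r k l` in the lower left corner generate all elements of
`whittaker n`. -/
theorem exists_sub_mem_I_of_mem_whittaker {y : Env n} (hy : y ∈ whittaker n) :
    ∃ w ∈ W', y - w ∈ I n := by
  have h : y ∈ filtUnion W' := filtUnion_eq_top hW hk hl hS ▸ Submodule.mem_top
  obtain ⟨m, hm⟩ := mem_filtUnion.1 h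
  exact exists_sub_mem_I_of_mem_filt_zero (mem_filt_zero_of_mem_whittaker hW hy m hm)

end Generation

end Queer

/-! ### Parity components -/

section Parity

variable {A S : Type*} [Ring A] [Algebra ℂ A] (g : S → A) (p : S → ZMod 2)

theorem one_mem_parityPart : (1 : A) ∈ parityPart g p 0 :=
  Submodule.subset_span ⟨[], rfl, rfl⟩

theorem gen_mem_parityPart (s : S) : g s ∈ parityPart g p (p s) :=
  Submodule.subset_span ⟨[s], by simp, by simp⟩

theorem mul_mem_parityPart {a b : ZMod 2} {x y : A} (hx : x ∈ parityPart g p a)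
    (hy : y ∈ parityPart g p b) : x * y ∈ parityPart g p (a + b) := by
  have h := Submodule.mul_mem_mul hx hy
  unfold parityPart at h
  rw [Submodule.span_mul_span] at h
  refine Submodule.span_mono ?_ h
  rintro _ ⟨_, ⟨l, hl, rfl⟩, _, ⟨l', hl', rfl⟩, rfl⟩
  exact ⟨l ++ l', by simp [hl, hl'], by simp⟩

end Parity

/-! ### Homomorphisms out of `Y(Q(1))` -/

namespace SuperYangian

section Lift

variable {A : Type*} [Ring A] [Algebra ℂ A] (w : ZMod 2 → ℤ → A)

/-- The image of the coefficient of `u^{-r}` in `T_{i,j}(u)` under the homomorphism determined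
by the images of the coefficients of `T_{1,1}(u)` and `T_{-1,1}(u)`. -/
def genImage (i j : Idx 1) (r : ℤ) : A :=
  (if par j = 0 then (-1 : ℂ) ^ r else 1) • w (par i + par j) r

/-- The map from the free algebra on the generators of `Y(Q(1))` determined by `genImage`. -/
def freeHom : FreeAlgebra ℂ (Gen 1) →ₐ[ℂ] A :=
  FreeAlgebra.lift ℂ fun q => genImage w q.1 q.2.1 (q.2.2 + 1 : ℕ)

/-- The quadratic expressions in which the supercommutators expand. -/
def quad (c c' : ZMod 2) (r p q : ℤ) : A :=
  Queer.sg c c' • (w c' p * w c q)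
    + ((-1 : ℂ) ^ (r + p) * Queer.sg (c + 1) c') • (w (c' + 1) p * w (c + 1) q)

/-- The supercommutators. -/
def scomm (c c' : ZMod 2) (r s : ℤ) : A :=
  w c r * w c' s - Queer.sg c c' • (w c' s * w c r)

variable {w} (hw : ∀ c r, r ≤ 0 → w c r = if c = 0 ∧ r = 0 then 1 else 0)

include hw in
theorem freeHom_freeT (i j : Idx 1) (r : ℤ) :
    freeHom w (freeT i j r) = genImage w i j r := by
  match r with
  | Int.ofNat 0 =>
    have h : par i + par j = 0 ↔ i = j := by
      obtain ⟨i1, i2⟩ := i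
      obtain ⟨j1, j2⟩ := j
      have hs : i1 = j1 := Subsingleton.elim _ _
      simp only [par, Prod.mk.injEq, hs, true_and]
      revert i2 j2
      decide
    simp only [freeT, genImage, Int.ofNat_eq_natCast, Nat.cast_zero, zpow_zero, ite_self,
      one_smul, hw _ 0 le_rfl, and_true, h]
    split_ifs <;> simp
  | Int.ofNat (r + 1) =>
    simp only [freeT, freeHom, FreeAlgebra.lift_ι_apply]
    rfl
  | Int.negSucc r =>
    have : Int.negSucc r < 0 := Int.negSucc_lt_zero r
    simp only [freeT, genImage, map_zero, hw _ _ this.le, this.ne, and_false,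
      if_false, smul_zero]

variable (hq : ∀ c c' r s, scomm w c c' (r + 2) s - scomm w c c' r (s + 2) =
  quad w c c' r s (r + 1) + quad w c c' r (s + 1) r
    - quad w c c' r r (s + 1) - quad w c c' r (r + 1) s)

set_option maxHeartbeats 8000000 in
include hw hq in
-- The sign in `genImage` encodes the symmetry $T_{-i,-j}(u)=T_{i,j}(-u)$. After it, each quadratic
-- relation depends on its indices only through the parities `i + j` and `k + l`, up to an overall
-- sign.
theorem freeHom_rel {x y : FreeAlgebra ℂ (Gen 1)} (h : Rel 1 x y) : freeHom w x = freeHom w y := by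
  induction h with
  | sym i j r =>
    rw [map_smul, freeHom_freeT hw, freeHom_freeT hw]
    obtain ⟨i1, i⟩ := i
    obtain ⟨j1, j⟩ := j
    rcases neg_one_pow_eq_or ℂ r with hr | hr <;>
    rcases ZMod.two_cases i with rfl | rfl <;> rcases ZMod.two_cases j with rfl | rfl <;>
      simp [genImage, par, opp, hr, ZMod.one_add_one_two]
  | quad i j k l r s =>
    simp only [freeComm, map_smul, map_sub, map_add, map_mul, freeHom_freeT hw]
    obtain ⟨i1, i⟩ := i
    obtain ⟨j1, j⟩ := j
    obtain ⟨k1, k⟩ := k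
    obtain ⟨l1, l⟩ := l
    have h := hq (i + j) (k + l) r s
    simp only [scomm, quad] at h
    have hpm : ∀ a : ℤ, (-1 : ℂ) ^ a = 1 ∨ (-1 : ℂ) ^ a = -1 := by
      intro a
      rcases Int.even_or_odd a with ha | ha
      · exact Or.inl ha.neg_one_zpow
      · exact Or.inr ha.neg_one_zpow
    have hadd : ∀ a b : ℤ, (-1 : ℂ) ^ (a + b) = (-1) ^ a * (-1) ^ b := fun a b =>
      zpow_add₀ (by norm_num) a b
    simp only [genImage, par, opp, hadd] at h ⊢
    clear hw hq
    rcases hpm r with hr | hr <;> rcases hpm s with hs | hs <;>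
    rcases ZMod.two_cases i with rfl | rfl <;> rcases ZMod.two_cases j with rfl | rfl <;>
    rcases ZMod.two_cases k with rfl | rfl <;> rcases ZMod.two_cases l with rfl | rfl <;>
    simp [hr, hs, ZMod.one_add_one_two, ZMod.val_one] at h ⊢ <;>
    first
      | linear_combination (norm := abel1) h
      | linear_combination (norm := abel1) -h

/-- The homomorphism from `Y(Q(1))` determined by `genImage`. -/
def lift : SuperYangian 1 →ₐ[ℂ] A :=
  RingQuot.liftAlgHom ℂ ⟨freeHom w, fun _ _ h => freeHom_rel hw hq h⟩

theorem lift_T (i j : Idx 1) (r : ℕ) : lift hw hq (T i j r) = genImage w i j r := by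
  have h := RingQuot.liftAlgHom_mkAlgHom_apply ℂ (freeHom w)
    (fun _ _ h => freeHom_rel hw hq h) (freeT i j r)
  exact h.trans (freeHom_freeT hw i j r)

end Lift

end SuperYangian

/-! ### The homomorphism to `W_χ` and its surjectivity -/

namespace Queer

variable {n : ℕ}

theorem X_mem_envPart (c : ZMod 2) (i j : Fin n) : X c i j ∈ envPart n c :=
  gen_mem_parityPart (S := {q : ZMod 2 × Queer n // q.2 ∈ part n q.1})
    (fun q => ι n q.1.2) (fun q => q.1.1) ⟨(c, basisElt c i j), basisElt_mem_part c i j⟩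

theorem one_mem_envPart : (1 : Env n) ∈ envPart n 0 := one_mem_parityPart _ _

theorem mul_mem_envPart {a b : ZMod 2} {x y : Env n} (hx : x ∈ envPart n a)
    (hy : y ∈ envPart n b) : x * y ∈ envPart n (a + b) := mul_mem_parityPart _ _ hx hy

theorem S_mem_envPart (c : ZMod 2) (r : ℕ) (i j : Fin n) : S c r i j ∈ envPart n c := by
  induction r generalizing c i with
  | zero =>
    rcases ZMod.two_cases c with rfl | rfl
    · rw [S_zero_zero]
      split_ifs
      · exact one_mem_envPart
      · exact Submodule.zero_mem _
    · exact Submodule.zero_mem _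
  | succ r ih =>
    rw [S_succ]
    refine Submodule.add_mem _ (Submodule.sum_mem _ fun k _ => ?_)
      (Submodule.smul_mem _ _ (Submodule.sum_mem _ fun k _ => ?_))
    · simpa using mul_mem_envPart (X_mem_envPart 0 i k) (ih c k)
    · have := mul_mem_envPart (X_mem_envPart 1 i k) (ih (c + 1) k)
      rwa [add_comm c 1, ← add_assoc, ZMod.one_add_one_two, zero_add, add_comm 1 c] at this

theorem one_mem_wPart : (1 : W n) ∈ wPart n 0 :=
  ⟨1, one_mem_envPart, map_one (proj n)⟩

theorem mul_mem_wPart {a b : ZMod 2} {x y : W n} (hx : x ∈ wPart n a) (hy : y ∈ wPart n b) :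
    x * y ∈ wPart n (a + b) := by
  obtain ⟨x, hx, rfl⟩ := hx
  obtain ⟨y, hy, rfl⟩ := hy
  exact ⟨x * y, mul_mem_envPart hx hy, map_mul (proj n) x y⟩

theorem proj_eq_proj {x y : whittaker n} (h : (x : Env n) - y ∈ I n) : proj n x = proj n y :=
  Ideal.Quotient.eq.2 h

section Corner

variable {k l : Fin n} (hk : (k : ℕ) + 1 = n) (hl : (l : ℕ) = 0)

include hk hl in
theorem SZ_mem_whittaker (c : ZMod 2) (r : ℤ) : SZ c r k l ∈ whittaker n := by
  rw [SZ]
  split_ifs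
  · exact S_mem_whittaker c _ k l hk hl
  · exact zero_mem _

/-- The classes in `W_χ` of the elements in the lower left corner, with the degree shifted. -/
def wS (c : ZMod 2) (r : ℤ) : W n := proj n ⟨SZ c (r + n - 1) k l, SZ_mem_whittaker hk hl c _⟩

/-- Degrees `r ≤ 0` correspond to unshifted degrees at most `n - 1`, the index of the last row,
where `S_sub_mem_I` applies. -/
theorem wS_of_nonpos (c : ZMod 2) (r : ℤ) (hr : r ≤ 0) :
    wS hk hl c r = if c = 0 ∧ r = 0 then 1 else 0 := by
  have h : SZ c (r + n - 1) k l - (if c = 0 ∧ r = 0 then 1 else 0) ∈ I n := by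
    by_cases h0 : 0 ≤ r + n - 1
    · rw [SZ, if_pos h0]
      have := S_sub_mem_I (r + n - 1).toNat l hl c k (by omega)
      have h1 : (r + n - 1).toNat = (k : ℕ) ↔ r = 0 := by omega
      simpa only [h1] using this
    · have : r ≠ 0 := by omega
      simp [SZ_of_neg c (not_le.1 h0), this]
  split_ifs at h ⊢ with hc
  · exact (proj_eq_proj (y := 1) h).trans (map_one _)
  · exact (proj_eq_proj (y := 0) h).trans (map_zero _)

theorem wS_mem_wPart (c : ZMod 2) (r : ℤ) : wS hk hl c r ∈ wPart n c := by
  refine ⟨⟨SZ c (r + n - 1) k l, SZ_mem_whittaker hk hl c _⟩, ?_, rfl⟩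
  change SZ c (r + n - 1) k l ∈ envPart n c
  rw [SZ]
  split_ifs
  · exact S_mem_envPart _ _ _ _
  · exact Submodule.zero_mem _

theorem scomm_wS_sub_scomm_wS (c c' : ZMod 2) (r s : ℤ) :
    SuperYangian.scomm (wS hk hl) c c' (r + 2) s - SuperYangian.scomm (wS hk hl) c c' r (s + 2) =
      SuperYangian.quad (wS hk hl) c c' r s (r + 1) + SuperYangian.quad (wS hk hl) c c' r (s + 1) r
        - SuperYangian.quad (wS hk hl) c c' r r (s + 1)
        - SuperYangian.quad (wS hk hl) c c' r (r + 1) s := by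
  -- The signs involve a sum of two degrees, so the shift changes the exponent by the even number `2
  -- * (n - 1)`.
  have hsign : ∀ a b : ℤ, (-1 : ℂ) ^ (a + n - 1 + (b + n - 1)) = (-1) ^ (a + b) := by
    intro a b
    rw [show a + n - 1 + (b + n - 1) = a + b + 2 * (n - 1) by ring, zpow_add₀ (by norm_num),
      _root_.zpow_mul]
    norm_num
  have h := commZ_sub_commZ c c' (r + n - 1) (s + n - 1) k l k l
  simp only [quadTermZ, commZ] at h
  rw [show s + n - 1 + 1 = s + 1 + n - 1 by ring, show r + n - 1 + 1 = r + 1 + n - 1 by ring,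
    show s + n - 1 + 2 = s + 2 + n - 1 by ring, show r + n - 1 + 2 = r + 2 + n - 1 by ring] at h
  simp only [hsign] at h
  let s' : ZMod 2 → ℤ → whittaker n := fun c r => ⟨SZ c (r + n - 1) k l, SZ_mem_whittaker hk hl c _⟩
  have h' : s' c (r + 2) * s' c' s - sg c c' • (s' c' s * s' c (r + 2))
      - (s' c r * s' c' (s + 2) - sg c c' • (s' c' (s + 2) * s' c r)) =
      sg c c' • (s' c' s * s' c (r + 1))
        + ((-1 : ℂ) ^ (r + s) * sg (c + 1) c') • (s' (c' + 1) s * s' (c + 1) (r + 1))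
      + (sg c c' • (s' c' (s + 1) * s' c r)
        + ((-1 : ℂ) ^ (r + (s + 1)) * sg (c + 1) c') • (s' (c' + 1) (s + 1) * s' (c + 1) r))
      - (sg c c' • (s' c' r * s' c (s + 1))
        + ((-1 : ℂ) ^ (r + r) * sg (c + 1) c') • (s' (c' + 1) r * s' (c + 1) (s + 1)))
      - (sg c c' • (s' c' (r + 1) * s' c s)
        + ((-1 : ℂ) ^ (r + (r + 1)) * sg (c + 1) c') • (s' (c' + 1) (r + 1) * s' (c + 1) s)) :=
    Subtype.ext h
  have h2 := congrArg (proj n) h'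
  simp only [map_sub, map_add, map_smul, map_mul] at h2
  exact h2

open SuperYangian

/-- The homomorphism from `Y(Q(1))` to `W_χ`. -/
def yangianHom : SuperYangian 1 →ₐ[ℂ] W n :=
  lift (wS_of_nonpos hk hl) (scomm_wS_sub_scomm_wS hk hl)

theorem yangianHom_T (i j : Idx 1) (r : ℕ) :
    yangianHom hk hl (T i j r) = genImage (wS hk hl) i j r := lift_T _ _ i j r

theorem yangianHom_mem_wPart (d : ZMod 2) (y : SuperYangian 1) (hy : y ∈ yPart 1 d) :
    yangianHom hk hl y ∈ wPart n d := by
  have : yPart 1 d ≤ (wPart n d).comap (yangianHom hk hl).toLinearMap := by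
    refine Submodule.span_le.2 ?_
    rintro _ ⟨s, rfl, rfl⟩
    clear hy
    change yangianHom hk hl _ ∈ wPart n _
    induction s with
    | nil => exact (map_one (yangianHom hk hl)).symm ▸ one_mem_wPart (n := n)
    | cons q s ih =>
      simp only [List.map_cons, List.prod_cons, List.sum_cons, map_mul] at ih ⊢
      refine mul_mem_wPart ?_ ih
      rw [yangianHom_T]
      exact Submodule.smul_mem _ _ (wS_mem_wPart hk hl _ _)
  exact this hy

theorem wS_mem_range (c : ZMod 2) (r : ℤ) : wS hk hl c r ∈ (yangianHom hk hl).range := by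
  by_cases hr : 0 ≤ r
  · lift r to ℕ using hr
    have h : (-1 : ℂ) ^ r • yangianHom hk hl (T (0, c) (0, 0) r) = wS hk hl c r := by
      rw [yangianHom_T, genImage]
      simp [par, smul_smul, ← mul_pow]
    rw [← h]
    exact Subalgebra.smul_mem _ (AlgHom.mem_range_self _ _) _
  · rw [wS_of_nonpos hk hl c r (by omega), if_neg (by omega)]
    exact zero_mem _

theorem yangianHom_surjective : Function.Surjective (yangianHom hk hl) := by
  rw [← AlgHom.range_eq_top, eq_top_iff]
  rintro x -
  obtain ⟨⟨y, hy⟩, rfl⟩ := Ideal.Quotient.mkₐ_surjective ℂ (whittakerKer n) x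
  let W' : Subalgebra ℂ (Env n) := Algebra.adjoin ℂ
    (Set.range fun p : ZMod 2 × ℕ => S p.1 p.2 k l)
  have hS : ∀ c r, S c r k l ∈ W' := fun c r => Algebra.subset_adjoin ⟨(c, r), rfl⟩
  -- Corner elements of every degree have classes in the range, including those below degree `n`,
  -- whose classes are `0` or `1`.
  have hW' : W' ≤ ((yangianHom hk hl).range.comap (proj n)).map (whittaker n).val := by
    refine Algebra.adjoin_le ?_
    rintro _ ⟨⟨c, r⟩, rfl⟩
    refine ⟨⟨S c r k l, S_mem_whittaker c r k l hk hl⟩, ?_, rfl⟩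
    have h := wS_mem_range hk hl c (r - n + 1)
    have h1 : wS hk hl c (r - n + 1) = proj n ⟨S c r k l, S_mem_whittaker c r k l hk hl⟩ := by
      refine congrArg (proj n) (Subtype.ext ?_)
      change SZ c ((r : ℤ) - n + 1 + n - 1) k l = S c r k l
      rw [show (r : ℤ) - n + 1 + n - 1 = r by ring, SZ_natCast]
    rw [h1] at h
    exact h
  have hW : W' ≤ whittaker n := fun w hw => by
    obtain ⟨w, -, rfl⟩ := hW' hw
    exact w.2
  obtain ⟨w, hw, hyw⟩ := exists_sub_mem_I_of_mem_whittaker hW hk hl hS hy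
  obtain ⟨w, hwr, rfl⟩ := hW' hw
  have h : proj n ⟨y, hy⟩ = proj n w := proj_eq_proj hyw
  change proj n ⟨y, hy⟩ ∈ _
  rw [h]
  exact hwr

theorem yangianHom_T_eq (c : ZMod 2) (r : ℕ) (hr : 1 ≤ r) :
    ∃ h : S c (n + r - 1) k l ∈ whittaker n,
      yangianHom hk hl (T (0, c) (0, 0) r) = (-1 : ℂ) ^ r • proj n ⟨_, h⟩ := by
  refine ⟨S_mem_whittaker c _ k l hk hl, ?_⟩
  rw [yangianHom_T, genImage]
  simp only [par, if_true, add_zero, zpow_natCast]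
  refine congrArg ((-1 : ℂ) ^ r • ·) (congrArg (proj n) (Subtype.ext ?_))
  change SZ c ((r : ℤ) + n - 1) k l = S c (n + r - 1) k l
  rw [show (r : ℤ) + n - 1 = ((n + r - 1 : ℕ) : ℤ) by omega, SZ_natCast]

end Corner

end Queer

end

/-- The indices `n`, `1` of `Q(n)` are `⟨n - 1, _⟩`, `⟨0, _⟩` in `Fin n`; the indices `1`, `-1`
of `Y(Q(1))` are `(0, 0)`, `(0, 1)`. -/
theorem mainTheorem6 (n : ℕ) (hn : 1 ≤ n) :
    ∃ φ : SuperYangian 1 →ₐ[ℂ] Queer.W n,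
      Function.Surjective φ ∧
      (∀ (d : ZMod 2) (y : SuperYangian 1), y ∈ SuperYangian.yPart 1 d → φ y ∈ Queer.wPart n d) ∧
      ∀ k : ℕ, 1 ≤ k →
        (∃ he : Queer.eS (n + k - 1) ⟨n - 1, by omega⟩ ⟨0, hn⟩ ∈ Queer.whittaker n,
          φ (SuperYangian.T (0, 0) (0, 0) k) = (-1 : ℂ) ^ k • Queer.proj n ⟨_, he⟩) ∧
        (∃ hf : Queer.fS (n + k - 1) ⟨n - 1, by omega⟩ ⟨0, hn⟩ ∈ Queer.whittaker n,
          φ (SuperYangian.T (0, 1) (0, 0) k) = (-1 : ℂ) ^ k • Queer.proj n ⟨_, hf⟩) := by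
  have hk : ((⟨n - 1, by omega⟩ : Fin n) : ℕ) + 1 = n := Nat.sub_add_cancel hn
  have hl : ((⟨0, hn⟩ : Fin n) : ℕ) = 0 := rfl
  exact ⟨Queer.yangianHom hk hl, Queer.yangianHom_surjective hk hl,
    Queer.yangianHom_mem_wPart hk hl, fun k hk1 =>
      ⟨Queer.yangianHom_T_eq hk hl 0 k hk1, Queer.yangianHom_T_eq hk hl 1 k hk1⟩⟩
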